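/- Let $k$ be an algebraically closed field of characteristic $p>0$, $e\ge 0$, $q=p^e$, and let $\mathcal O\cong k[[X_1,X_2,X_3]]$ be the completed local ring, with maximal ideal $\mathfrak m$, of a nonsingular $3$-fold at a closed point $P$. Let $\mathcal R=\bigoplus_{n\ge 0}(I_n,n)$ be an idealistic filtration of i.f.g. type, i.e. a finitely generated graded $\mathcal O$-algebra given by ideals $\mathcal O=I_0\supseteq I_1\supseteq I_2\supseteq\cdots$ with $I_mI_n\subseteq I_{m+n}$ and $I_1\ne 0$, such that $P$ is in its singular locus, i.e. $I_n\subseteq\mathfrak m^n$ for all $n$. Let $E$ be the set of components through $P$ of the boundary $E_{\rm young}$, and let $H_x\in E$. A *choice of $h$ and $(x,y,z)$* consists of a regular system of parameters $(x,y,z)$ of $\mathcal O$, an element $h\in I_q$ and integers $\alpha,\beta\ge 0$, $a>0$ such that: (0) $H_x=\{x=0\}$, and either $E=\{H_x\}$ and $\beta=0$, or $E=\{H_x,H_y\}$ with $H_y=\{y=0\}$; (1) $h=z^q+a_1z^{q-1}+\cdots+a_q$ with $a_i\in k[[x,y]]$ and $\mathrm{ord}_P(a_i)>i$ for $1\le i\le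 q$, and $\{(h,q)\}$ is a leading generator system: the leading algebra $\bigoplus_n\{f \bmod \mathfrak m^{n+1} : (f,n)\in\mathcal D\mathcal R,\ f\in\mathfrak m^n\}$ of the differential saturation $\mathcal D\mathcal R$ (the smallest idealistic filtration containing $\mathcal R$ such that $(f,n)\in\mathcal D\mathcal R$ implies $(\delta f,\max\{n-\deg\delta,0\})\in\mathcal D\mathcal R$ for every $k$-linear differential operator $\delta$) is $k[z^q]$; (2) $(x^\alpha y^\beta,a)\in\mathcal R$; (3) $\mathcal R$ is saturated for the divided derivatives $\partial^n/\partial z^n$, $n\ge 0$: $(f,m)\in\mathcal R$ implies $(\partial^n f/\partial z^n,\max\{m-n,0\})\in\mathcal R$; (4) whenever $(f,\lambda)\in\mathcal R$ has the expansion $f=\sum_{b\ge 0}c_bh^b$ with $c_b\in\bigoplus_{j<q}k[[x,y]]z^j$, the monomial $x^{\lceil\alpha\lambda/a\rceil}y^{\lceil\beta\lambda/a\rceil}$ divides $c_0$. For such a choice put $\mu=\alpha/a$, $r=\mathrm{ord}_{\xi_{H_x}}(a_q)$ (the order of $a_q$ in $x$), $\mathrm{Slope}=\min\{r/q,\mu\}$,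 and, if $r<\infty$, write $a_q=x^r\{g(y)+x\,\omega(x,y)\}$ with $g\in k[[y]]$, $\omega\in k[[x,y]]$, and let $\mathrm{In}_{\xi_{H_x}}(a_q)=x^rg(y)$. The element $h$ is *well-adapted at $\xi_{H_x}$* with respect to $(x,y,z)$ if either $\mathrm{Slope}=\mu$, or $\mathrm{Slope}=r/q<\mu$ and $\mathrm{In}_{\xi_{H_x}}(a_q)$ is not a $q$-th power. The divisor $H_x$ is *bad* if $\mathrm{Slope}<\mu$ for some choice with $h$ well-adapted at $\xi_{H_x}$. For a power series $f$ let $\text{res-ord}^{(q)}_P(f)$ be the smallest degree of a term which appears in $f$ with nonzero coefficient and is not a $q$-th power. Proposition 7. Suppose that $H_x$ is bad. For every choice of $h$ and $(x,y,z)$ with $h$ well-adapted at $\xi_{H_x}$, both $r$ and $\text{res-ord}^{(q)}_P(\mathrm{In}_{\xi_{H_x}}(a_q))$ are finite; set $$\rho_{h,(x,y,z),H_x}(P)=\frac{\text{res-ord}^{(q)}_P\bigl(\mathrm{In}_{\xi_{H_x}}(a_q)\bigr)-r}{q}.$$ Then $\rho_{h,(x,y,z),H_x}(P)=\mathrm{ord}_P(g(y))/q$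 if $r\not\equiv0\bmod q$, and $\rho_{h,(x,y,z),H_x}(P)=\text{res-ord}^{(q)}_P(g(y))/q$ if $r\equiv0\bmod q$ (these being finite). Moreover the number $\rho_{h,(x,y,z),H_x}(P)$ is the same for all choices of $h$ and $(x,y,z)$ with $h$ well-adapted at $\xi_{H_x}$. -/

import Mathlib

open scoped ENNReal

noncomputable section

namespace MonomialCase

variable {k : Type*} [Field k]

/-- The complete local ring of a nonsingular `3`-fold over `k` at a closed point `P`. -/
abbrev LocalRing3 (k : Type*) [Field k] : Type _ := MvPowerSeries (Fin 3) k

/-- The maximal ideal of the point `P`. -/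
abbrev maxIdeal (k : Type*) [Field k] : Ideal (LocalRing3 k) :=
  IsLocalRing.maximalIdeal (LocalRing3 k)

/-- An idealistic filtration `⊕ₙ (Iₙ, n)`: a graded algebra of ideals with
`I₀ = O ⊇ I₁ ⊇ I₂ ⊇ ⋯` and `I₁ ≠ 0`. -/
structure IdealisticFiltration (k : Type*) [Field k] where
  ideal : ℕ → Ideal (LocalRing3 k)
  ideal_zero : ideal 0 = ⊤
  antitone : Antitone ideal
  mul_le : ∀ m n, ideal m * ideal n ≤ ideal (m + n)
  ideal_one_ne_bot : ideal 1 ≠ ⊥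

namespace IdealisticFiltration

/-- The graded algebra `⊕ₙ Iₙ Tⁿ ⊆ O[T]`. -/
def gradedAlgebra (R : IdealisticFiltration k) :
    Subalgebra (LocalRing3 k) (Polynomial (LocalRing3 k)) where
  carrier := {f | ∀ n, f.coeff n ∈ R.ideal n}
  mul_mem' := by
    intro f g hf hg n
    rw [Polynomial.coeff_mul]
    refine Ideal.sum_mem _ fun ij hij => ?_
    have h := R.mul_le ij.1 ij.2 (Ideal.mul_mem_mul (hf ij.1) (hg ij.2))
    rwa [Finset.HasAntidiagonal.mem_antidiagonal.mp hij] at h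
  add_mem' := by
    intro f g hf hg n
    rw [Polynomial.coeff_add]
    exact Ideal.add_mem _ (hf n) (hg n)
  algebraMap_mem' := by
    intro c n
    rw [Polynomial.algebraMap_apply, Polynomial.coeff_C]
    split_ifs with h
    · subst h
      rw [R.ideal_zero]
      exact Submodule.mem_top
    · exact Ideal.zero_mem _

/-- Of i.f.g. type: the graded algebra is finitely generated. -/
def IsIFG (R : IdealisticFiltration k) : Prop := R.gradedAlgebra.FG

/-- `P` is in the singular locus: `ord_P(Iₙ) ≥ n` for all `n`. -/
def IsSingular (R : IdealisticFiltration k) : Prop :=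
  ∀ n, R.ideal n ≤ maxIdeal k ^ n

end IdealisticFiltration

/-- `k`-linear differential operators of degree at most `n` (in Grothendieck's sense). -/
def IsDiffOp : ℕ → (LocalRing3 k →ₗ[k] LocalRing3 k) → Prop
  | 0, δ => ∀ f : LocalRing3 k,
      δ ∘ₗ LinearMap.mulLeft k f - LinearMap.mulLeft k f ∘ₗ δ = 0
  | n + 1, δ => ∀ f : LocalRing3 k,
      IsDiffOp n (δ ∘ₗ LinearMap.mulLeft k f - LinearMap.mulLeft k f ∘ₗ δ)

namespace IdealisticFiltration

/-- Closed under all differential operators: `(f, m) ∈ R` and `deg δ ≤ n` give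
`(δ f, max (m - n, 0)) ∈ R`. -/
def IsDiffSaturated (R : IdealisticFiltration k) : Prop :=
  ∀ (n : ℕ) (δ : LocalRing3 k →ₗ[k] LocalRing3 k), IsDiffOp n δ →
    ∀ m, ∀ f ∈ R.ideal m, δ f ∈ R.ideal (m - n)

/-- The level-`n` ideal of the differential saturation, the smallest differentially saturated
idealistic filtration containing `R`. -/
def diffSaturation (R : IdealisticFiltration k) (n : ℕ) : Ideal (LocalRing3 k) :=
  sInf {J | ∃ S : IdealisticFiltration k,
    S.IsDiffSaturated ∧ (∀ m, R.ideal m ≤ S.ideal m) ∧ J = S.ideal n}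

/-- The leading algebra of the differential saturation of `R`, that is, the subalgebra
`⊕ₙ {f mod 𝔪ⁿ⁺¹ | f ∈ (DR)ₙ ∩ 𝔪ⁿ}` of `⊕ₙ 𝔪ⁿ/𝔪ⁿ⁺¹`, equals `k[z^q]`. Both algebras are compared
degree by degree through the preimages in `𝔪ⁿ` of their degree-`n` pieces. -/
def LeadingAlgebraEq (R : IdealisticFiltration k) (z : LocalRing3 k) (q : ℕ) : Prop :=
  ∀ n, (R.diffSaturation n ⊓ maxIdeal k ^ n) ⊔ maxIdeal k ^ (n + 1) =
    Ideal.span {f | f = z ^ n ∧ q ∣ n} ⊔ maxIdeal k ^ (n + 1)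

end IdealisticFiltration

/-- `X = (x, y, z)` is a regular system of parameters. -/
def IsParameterSystem (X : Fin 3 → LocalRing3 k) : Prop :=
  Ideal.span (Set.range X) = maxIdeal k

/-- The element `F(x, y, z)`, for a power series `F` in three variables. -/
def eval3 (X : Fin 3 → LocalRing3 k) (F : MvPowerSeries (Fin 3) k) : LocalRing3 k :=
  MvPowerSeries.subst X F

/-- The element `F(x, y)` of the subring `k[[x, y]]`, for a power series `F` in two variables. -/
def eval2 (X : Fin 3 → LocalRing3 k) (F : MvPowerSeries (Fin 2) k) : LocalRing3 k :=
  MvPowerSeries.subst ![X 0, X 1] F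

/-- The `n`-th divided (Hasse) derivative in the last variable: `z^m ↦ (m choose n) z^(m-n)`. -/
def hasseZ (n : ℕ) (F : MvPowerSeries (Fin 3) k) : MvPowerSeries (Fin 3) k :=
  fun m => ((m 2 + n).choose n : k) * MvPowerSeries.coeff (m + Finsupp.single 2 n) F

/-- `R` is saturated for the divided derivatives `∂ⁿ/∂zⁿ` with respect to `(x, y, z)`. -/
def IsZSaturated (R : IdealisticFiltration k) (X : Fin 3 → LocalRing3 k) : Prop :=
  ∀ (n m : ℕ) (F : MvPowerSeries (Fin 3) k),
    eval3 X F ∈ R.ideal m → eval3 X (hasseZ n F) ∈ R.ideal (m - n)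

/-- `f = ∑ c_b h^b` is the power series expansion of `f` with respect to `h` and `(x, y, z)`:
each `c_b` lies in `⊕_{j < q} k[[x, y]] z^j`, and the series converges to `f`. -/
def IsExpansion (X : Fin 3 → LocalRing3 k) (q : ℕ) (h f : LocalRing3 k)
    (c : ℕ → LocalRing3 k) : Prop :=
  (∀ b, ∃ B : ℕ → MvPowerSeries (Fin 2) k,
    c b = ∑ j ∈ Finset.range q, eval2 X (B j) * X 2 ^ j) ∧
  ∀ N, f - ∑ b ∈ Finset.range N, c b * h ^ b ∈ maxIdeal k ^ N

/-- A choice of `h` and `(x, y, z)` in the monomial case with `τ = 1`, for the filtration `R`.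
`E` is the set of the ideals of the components of `E_young` through `P` (one or two of them), and
`D ∈ E` is the ideal of the component `H_x = {x = 0}`. -/
structure Situation (p e : ℕ) (R : IdealisticFiltration k) (E : Set (Ideal (LocalRing3 k)))
    (D : Ideal (LocalRing3 k)) where
  /-- the regular system of parameters `(x, y, z)` -/
  X : Fin 3 → LocalRing3 k
  /-- the element of the leading generator system -/
  h : LocalRing3 k
  /-- the coefficients `a_i` of `h`, as power series in `(x, y)`, for `1 ≤ i ≤ p^e` -/
  coeff : ℕ → MvPowerSeries (Fin 2) k
  /-- the monomial `x^α y^β` at level `a` -/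
  α : ℕ
  β : ℕ
  a : ℕ
  isParameterSystem : IsParameterSystem X
  h_mem : h ∈ R.ideal (p ^ e)
  h_eq : h = X 2 ^ p ^ e +
    ∑ i ∈ Finset.Icc 1 (p ^ e), eval2 X (coeff i) * X 2 ^ (p ^ e - i)
  order_coeff : ∀ i ∈ Finset.Icc 1 (p ^ e), (i : ℕ∞) < (coeff i).order
  leadingAlgebra : R.LeadingAlgebraEq (X 2) (p ^ e)
  H_x_eq : D = Ideal.span {X 0}
  boundary : (E = {Ideal.span {X 0}} ∧ β = 0) ∨ E = {Ideal.span {X 0}, Ideal.span {X 1}}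
  a_pos : 0 < a
  monomial_mem : X 0 ^ α * X 1 ^ β ∈ R.ideal a
  isZSaturated : IsZSaturated R X
  dvd_constantTerm : ∀ (n : ℕ), ∀ f ∈ R.ideal n, ∀ c : ℕ → LocalRing3 k,
    IsExpansion X (p ^ e) h f c →
      X 0 ^ ⌈(α : ℚ) * n / a⌉₊ * X 1 ^ ⌈(β : ℚ) * n / a⌉₊ ∣ c 0

/-- The order of a power series in `(x, y)` at the generic point of `{x = 0}`. -/
def ordX (f : MvPowerSeries (Fin 2) k) : ℕ∞ := emultiplicity (MvPowerSeries.X 0) f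

/-- The initial form at the generic point of `{x = 0}`: if `f = x^r (g(y) + x ω(x, y))` with
`r = ordX f`, this is `x^r g(y)`. -/
def initX (f : MvPowerSeries (Fin 2) k) : MvPowerSeries (Fin 2) k :=
  fun m => if (m 0 : ℕ∞) = ordX f then MvPowerSeries.coeff m f else 0

/-- The residual order: the smallest degree of a term which appears in `f` with nonzero
coefficient and which is not a `q`-th power (`⊤` if there is no such term). -/
def resOrd {ι : Type*} (q : ℕ) (f : MvPowerSeries ι k) : ℕ∞ :=
  sInf {d | ∃ m : ι →₀ ℕ, MvPowerSeries.coeff m f ≠ 0 ∧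
    (¬ ∃ w : MvPowerSeries ι k, MvPowerSeries.monomial m (MvPowerSeries.coeff m f) = w ^ q) ∧
    d = (m.degree : ℕ∞)}

namespace Situation

variable {p e : ℕ} {R : IdealisticFiltration k} {E : Set (Ideal (LocalRing3 k))}
  {D : Ideal (LocalRing3 k)}

/-- The constant term `a_{p^e}` of `h`. -/
def lastCoeff (S : Situation p e R E D) : MvPowerSeries (Fin 2) k := S.coeff (p ^ e)

/-- `μ(ξ_{H_x}) = α / a`. -/
def mu (S : Situation p e R E D) : ℝ≥0∞ := (S.α : ℝ≥0∞) / (S.a : ℝ≥0∞)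

/-- `Slope_{h,(x,y,z)}(ξ_{H_x}) = min {ord_{ξ_{H_x}}(a_{p^e}) / p^e, μ(ξ_{H_x})}`. -/
def slope (S : Situation p e R E D) : ℝ≥0∞ :=
  min ((ordX S.lastCoeff : ℝ≥0∞) / ((p ^ e : ℕ) : ℝ≥0∞)) S.mu

/-- `h` is well-adapted at `ξ_{H_x}` with respect to `(x, y, z)`. -/
def IsWellAdapted (S : Situation p e R E D) : Prop :=
  S.slope = S.mu ∨
  (S.slope = (ordX S.lastCoeff : ℝ≥0∞) / ((p ^ e : ℕ) : ℝ≥0∞) ∧ S.slope < S.mu ∧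
    ¬ ∃ w : MvPowerSeries (Fin 2) k, initX S.lastCoeff = w ^ p ^ e)

/-- The order `r` of `a_{p^e}` at `ξ_{H_x}`, as a natural number. -/
def r (S : Situation p e R E D) : ℕ := (ordX S.lastCoeff).toNat

/-- The number `ρ_{h,(x,y,z),H_x}(P)`. -/
def rho (S : Situation p e R E D) : ℚ :=
  (((resOrd (p ^ e) (initX S.lastCoeff)).toNat : ℚ) - (S.r : ℚ)) / ((p ^ e : ℕ) : ℚ)

end Situation

/-- The boundary divisor with ideal `D` is bad: `H(ξ_{H_x}) < μ(ξ_{H_x})`, where `H(ξ_{H_x})` is the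
slope of a choice of `h` and `(x, y, z)` with `h` well-adapted at `ξ_{H_x}`. -/
def IsBad (p e : ℕ) (R : IdealisticFiltration k) (E : Set (Ideal (LocalRing3 k)))
    (D : Ideal (LocalRing3 k)) : Prop :=
  ∃ S : Situation p e R E D, S.IsWellAdapted ∧ S.slope < S.mu

end MonomialCase

end

/-! Well-adaptedness normalizes only the initial form of `a_q`, so invariance is proved by
characterizing the pair (r, d), with ρ = d/q, through data that hardly see the coordinates.

Consider sections π : O → k[[x,y]] that preserve `H_x`, are transversal, and are tangent to z = 0
along `H_x` (`IsSection`). Order the ideals (x^(i+1), x^i y^j) by the lexicographic order of (i, j)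
(`LexDvd`). In normal form a_q = x^r (g + xω) with g = G^q + y^d · unit, where G = 0 if q ∤ r, and q
∤ d if q ∣ r. Then (r, d) is the largest pair (i, j) such that π(h) lies in (x^(i+1), x^i y^j) for
some section π.

The value is attained by z ↦ -x^(r/q) G(y), which cancels the q-th power
(`HasNormalForm.exists_lexDvd`). It cannot be exceeded (`HasNormalForm.not_lexDvd`): saturation
under ∂/∂z puts a_1, …, a_(q-1) strictly above the Newton segment of slope r/q < μ, so in the
x^r-coefficient of π(h) only z^q and a_q survive. If q ∤ r, then z^q disappears as well. If q ∣ r,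
it adds a q-th power, by additivity of Frobenius, and y^d is not a q-th power.

Two choices are compared by Weierstrass division. Dividing one h by the other leaves a remainder
divisible by x^⌈μq⌉, hence by x^(r+1), and the quotient is a unit (`exists_eq_add_mul`). Both
elements h therefore have the same sections and lie in the same ideals (x^(r+1), x^r y^j) after π,
which gives `HasNormalForm.unique`.

Finally, badness for one choice forces Slope < μ for every choice (`HasNormalForm.slope_lt_mu`), so
every well-adapted choice has a normal form. This uses that μ does not drop from one choice to
another (`mul_a_le`). -/

noncomputable section

namespace MonomialCase

variable {k : Type*} [Field k]

/-! ### Solving g + T g = f for a weight-raising operator T -/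

section Contraction

variable {σ : Type*} (w : (σ →₀ ℕ) → ℕ)

/-- `f` has no terms of weight less than `n`. -/
def VanishesBelow (n : ℕ) (f : MvPowerSeries σ k) : Prop :=
  ∀ m, w m < n → MvPowerSeries.coeff m f = 0

/-- `T` strictly raises the filtration by weight. -/
def RaisesWeight (T : MvPowerSeries σ k →+ MvPowerSeries σ k) : Prop :=
  ∀ n f, VanishesBelow w n f → VanishesBelow w (n + 1) (T f)

variable {w} {T : MvPowerSeries σ k →+ MvPowerSeries σ k}

theorem RaisesWeight.injective (hT : RaisesWeight w T) {g : MvPowerSeries σ k}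
    (hg : g + T g = 0) : g = 0 := by
  have h : ∀ n, VanishesBelow w n g := by
    intro n
    induction n with
    | zero => intro m hm; omega
    | succ n ih =>
      intro m hm
      rw [eq_neg_of_add_eq_zero_left hg, map_neg, hT n g ih m hm, neg_zero]
  ext m
  exact h (w m + 1) m (by omega)

theorem RaisesWeight.surjective (hT : RaisesWeight w T) (f : MvPowerSeries σ k) :
    ∃ g, g + T g = f := by
  -- Picard iteration. The coefficient at `m` is constant from step `w m + 1` on, so the limit
  -- exists coefficientwise even when a weight has infinitely many monomials.
  let G : ℕ → MvPowerSeries σ k := fun n => Nat.rec 0 (fun _ g => f - T g) n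
  have hG : ∀ n, G (n + 1) = f - T (G n) := fun n => rfl
  have step : ∀ n, VanishesBelow w n (G (n + 1) - G n) := by
    intro n
    induction n with
    | zero => intro m hm; omega
    | succ n ih =>
      have : G (n + 1 + 1) - G (n + 1) = - T (G (n + 1) - G n) := by
        rw [map_sub, hG (n + 1)]
        nth_rewrite 2 [hG n]
        abel
      intro m hm
      rw [this, map_neg, hT n _ ih m hm, neg_zero]
  have stable : ∀ m j, MvPowerSeries.coeff m (G (w m + 1 + j)) =
      MvPowerSeries.coeff m (G (w m + 1)) := by
    intro m j
    induction j with
    | zero => rfl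
    | succ j ih =>
      rw [← ih, ← sub_eq_zero, ← map_sub]
      exact step (w m + 1 + j) m (Nat.lt_of_lt_of_le (Nat.lt_succ_self _) (Nat.le_add_right _ _))
  let g : MvPowerSeries σ k := fun m => MvPowerSeries.coeff m (G (w m + 1))
  have hg : ∀ n, VanishesBelow w n (g - G n) := by
    intro n m hm
    obtain ⟨j, rfl⟩ := Nat.exists_eq_add_of_lt hm
    rw [map_sub, sub_eq_zero, add_right_comm, stable]
    rfl
  refine ⟨g, ?_⟩
  ext m
  have h1 := hT _ _ (hg (w m)) m (by omega)
  have h2 := hg (w m + 1) m (by omega)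
  rw [map_sub, map_sub, sub_eq_zero] at h1
  rw [map_sub, sub_eq_zero] at h2
  rw [map_add, h1, h2, hG, map_sub]
  abel

end Contraction

/-! ### Algebra maps of power series rings and regular systems of parameters -/

theorem mem_maximalIdeal_iff {σ : Type*} {f : MvPowerSeries σ k} :
    f ∈ IsLocalRing.maximalIdeal (MvPowerSeries σ k) ↔ MvPowerSeries.constantCoeff f = 0 := by
  rw [IsLocalRing.mem_maximalIdeal, mem_nonunits_iff, MvPowerSeries.isUnit_iff_constantCoeff,
    isUnit_iff_ne_zero, not_not]

/-- Were the constant terms different, f minus the constant term of ψ f would be a unit sent to a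
non-unit. No continuity of ψ is assumed here or in the order estimates below. -/
theorem constantCoeff_algHom {σ τ : Type*} (ψ : MvPowerSeries σ k →ₐ[k] MvPowerSeries τ k)
    (f : MvPowerSeries σ k) :
    MvPowerSeries.constantCoeff (ψ f) = MvPowerSeries.constantCoeff f := by
  by_contra h
  have hu : IsUnit (f - MvPowerSeries.C (MvPowerSeries.constantCoeff (ψ f))) := by
    rw [MvPowerSeries.isUnit_iff_constantCoeff, isUnit_iff_ne_zero, map_sub,
      MvPowerSeries.constantCoeff_C, sub_ne_zero]
    exact fun h' => h h'.symm
  have hu' := hu.map ψ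
  rw [map_sub, MvPowerSeries.c_eq_algebraMap, AlgHom.commutes,
    MvPowerSeries.isUnit_iff_constantCoeff, isUnit_iff_ne_zero, map_sub,
    ← MvPowerSeries.c_eq_algebraMap, MvPowerSeries.constantCoeff_C, sub_self] at hu'
  exact hu' rfl

/-- A power series of order at least `n + 1` is a combination of the variables with
coefficients of order at least `n`. -/
theorem exists_eq_sum_X_mul {σ : Type*} [Fintype σ] {n : ℕ} {f : MvPowerSeries σ k}
    (hf : ((n + 1 : ℕ) : ℕ∞) ≤ f.order) :
    ∃ F : σ → MvPowerSeries σ k, (∀ i, (n : ℕ∞) ≤ (F i).order) ∧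
      f = ∑ i, MvPowerSeries.X i * F i := by
  classical
  -- Each nonconstant monomial is assigned to one variable dividing it; `F i` collects the monomials
  -- assigned to the i-th variable, divided by it.
  have hpick : ∀ m : σ →₀ ℕ, ∃ i : Option σ, (m = 0 → i = none) ∧
      (m ≠ 0 → ∃ j, i = some j ∧ m j ≠ 0) := by
    intro m
    by_cases hm : m = 0
    · exact ⟨none, fun _ => rfl, fun h => (h hm).elim⟩
    · obtain ⟨j, hj⟩ := Finsupp.ne_iff.mp hm
      exact ⟨some j, fun h => (hm h).elim, fun _ => ⟨j, rfl, hj⟩⟩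
  choose pick hp0 hp1 using hpick
  let F : σ → MvPowerSeries σ k := fun i m => if pick (m + Finsupp.single i 1) = some i then
    MvPowerSeries.coeff (m + Finsupp.single i 1) f else 0
  refine ⟨F, ?_, ?_⟩
  · intro i
    refine MvPowerSeries.nat_le_order fun d hd => ?_
    change (if _ then _ else _) = _
    split_ifs
    · refine MvPowerSeries.coeff_of_lt_order (lt_of_lt_of_le ?_ hf)
      rw [map_add, Finsupp.degree_single]
      exact_mod_cast Nat.succ_lt_succ hd
    · rfl
  · ext m
    rw [map_sum]
    have hterm : ∀ i, MvPowerSeries.coeff m (MvPowerSeries.X i * F i) =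
        if pick m = some i then MvPowerSeries.coeff m f else 0 := by
      intro i
      rw [MvPowerSeries.X_def, MvPowerSeries.coeff_monomial_mul]
      by_cases hi : m i = 0
      · rw [if_neg, if_neg]
        · intro h
          by_cases hm : m = 0
          · rw [hp0 m hm] at h; cases h
          · obtain ⟨j, hj, hj'⟩ := hp1 m hm
            rw [hj] at h
            cases h
            exact hj' hi
        · rw [Finsupp.single_le_iff]; omega
      · rw [if_pos (by rw [Finsupp.single_le_iff]; omega), one_mul]
        change (if pick (m - _ + _) = _ then _ else _) = _
        rw [tsub_add_cancel_of_le (by rw [Finsupp.single_le_iff]; omega)]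
    rw [Finset.sum_congr rfl fun i _ => hterm i]
    by_cases hm : m = 0
    · rw [Finset.sum_eq_zero fun i _ => by rw [hp0 m hm, if_neg (by simp)]]
      refine MvPowerSeries.coeff_of_lt_order (lt_of_lt_of_le ?_ hf)
      rw [hm, map_zero]
      exact_mod_cast Nat.succ_pos n
    · obtain ⟨j, hj, -⟩ := hp1 m hm
      rw [Finset.sum_eq_single j, if_pos hj]
      · intro b _ hb
        rw [if_neg]
        rw [hj]
        exact fun h => hb (Option.some.inj h).symm
      · simp

theorem le_order_sum {σ ι : Type*} (s : Finset ι) (F : ι → MvPowerSeries σ k) {n : ℕ∞}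
    (h : ∀ i ∈ s, n ≤ (F i).order) : n ≤ (∑ i ∈ s, F i).order :=
  MvPowerSeries.le_order fun d hd => by
    rw [map_sum]
    exact Finset.sum_eq_zero fun i hi => MvPowerSeries.coeff_of_lt_order (hd.trans_le (h i hi))

theorem le_order_mul_of_le {σ : Type*} {f g : MvPowerSeries σ k} {m n : ℕ}
    (hf : (m : ℕ∞) ≤ f.order) (hg : (n : ℕ∞) ≤ g.order) : ((m + n : ℕ) : ℕ∞) ≤ (f * g).order := by
  push_cast
  exact (add_le_add hf hg).trans MvPowerSeries.le_order_mul

theorem order_algHom_sub {σ : Type*} [Fintype σ] (ψ : MvPowerSeries σ k →ₐ[k] MvPowerSeries σ k)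
    (hψ : ∀ i, ((2 : ℕ) : ℕ∞) ≤ (ψ (MvPowerSeries.X i) - MvPowerSeries.X i).order) (n : ℕ) :
    ∀ f : MvPowerSeries σ k, (n : ℕ∞) ≤ f.order → ((n + 1 : ℕ) : ℕ∞) ≤ (ψ f - f).order := by
  induction n with
  | zero =>
    intro f _
    rw [zero_add, Nat.cast_one, MvPowerSeries.one_le_order_iff_constCoeff_eq_zero, map_sub,
      constantCoeff_algHom, sub_self]
  | succ n ih =>
    intro f hf
    obtain ⟨F, hF, rfl⟩ := exists_eq_sum_X_mul hf
    rw [map_sum, ← Finset.sum_sub_distrib]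
    refine le_order_sum _ _ fun i _ => ?_
    have h1 : ψ (MvPowerSeries.X i * F i) - MvPowerSeries.X i * F i =
        (ψ (MvPowerSeries.X i) - MvPowerSeries.X i) * F i +
        (ψ (MvPowerSeries.X i) - MvPowerSeries.X i) * (ψ (F i) - F i) +
        MvPowerSeries.X i * (ψ (F i) - F i) := by
      rw [map_mul]; ring
    have hX : ((1 : ℕ) : ℕ∞) ≤ (MvPowerSeries.X i : MvPowerSeries σ k).order := by
      rw [Nat.cast_one, MvPowerSeries.one_le_order_iff_constCoeff_eq_zero,
        MvPowerSeries.constantCoeff_X]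
    have a1 := le_order_mul_of_le (hψ i) (hF i)
    have a2 := le_order_mul_of_le (hψ i) (ih _ (hF i))
    have a3 := le_order_mul_of_le hX (ih _ (hF i))
    rw [h1]
    refine le_trans (le_min (le_trans (le_min ?_ ?_) MvPowerSeries.min_order_le_add) ?_)
      MvPowerSeries.min_order_le_add
    · exact le_trans (by norm_cast; omega) a1
    · exact le_trans (by norm_cast; omega) a2
    · exact le_trans (by norm_cast; omega) a3

/-- ψ is the identity plus an operator that raises degree, by `order_algHom_sub`. -/
theorem bijective_of_order_sub {σ : Type*} [Fintype σ]
    (ψ : MvPowerSeries σ k →ₐ[k] MvPowerSeries σ k)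
    (hψ : ∀ i, ((2 : ℕ) : ℕ∞) ≤ (ψ (MvPowerSeries.X i) - MvPowerSeries.X i).order) :
    Function.Bijective ψ := by
  let T : MvPowerSeries σ k →+ MvPowerSeries σ k :=
    (ψ : MvPowerSeries σ k →+ MvPowerSeries σ k) - AddMonoidHom.id _
  have hTf : ∀ f, f + T f = ψ f := fun f => by
    change f + (ψ f - f) = ψ f
    ring
  have hT : RaisesWeight (fun m : σ →₀ ℕ => m.degree) T := by
    intro n f hf m hm
    exact MvPowerSeries.coeff_of_lt_order (lt_of_lt_of_le (by exact_mod_cast hm)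
      (order_algHom_sub ψ hψ n f (MvPowerSeries.nat_le_order hf)))
  constructor
  · rw [injective_iff_map_eq_zero]
    intro f hf
    exact hT.injective ((hTf f).trans hf)
  · intro f
    obtain ⟨g, hg⟩ := hT.surjective f
    exact ⟨g, (hTf g).symm.trans hg⟩

theorem IsParameterSystem.constantCoeff {X : Fin 3 → LocalRing3 k} (hX : IsParameterSystem X)
    (i : Fin 3) : MvPowerSeries.constantCoeff (X i) = 0 := by
  rw [← mem_maximalIdeal_iff]
  change X i ∈ maxIdeal k
  rw [← hX]
  exact Ideal.subset_span ⟨i, rfl⟩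

theorem IsParameterSystem.hasSubst {X : Fin 3 → LocalRing3 k} (hX : IsParameterSystem X) :
    MvPowerSeries.HasSubst X :=
  MvPowerSeries.hasSubst_of_constantCoeff_zero hX.constantCoeff

theorem two_le_order_mul_sub {σ : Type*} {c x : MvPowerSeries σ k}
    (hx : MvPowerSeries.constantCoeff x = 0) :
    ((2 : ℕ) : ℕ∞) ≤ ((c - MvPowerSeries.C (MvPowerSeries.constantCoeff c)) * x).order := by
  refine le_order_mul_of_le (m := 1) (n := 1) ?_ ?_ <;>
  rw [Nat.cast_one, MvPowerSeries.one_le_order_iff_constCoeff_eq_zero]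
  · rw [map_sub, MvPowerSeries.constantCoeff_C, sub_self]
  · exact hx

/-- The coordinate change attached to a regular system of parameters is bijective. -/
theorem IsParameterSystem.bijective {X : Fin 3 → LocalRing3 k} (hX : IsParameterSystem X) :
    Function.Bijective (MvPowerSeries.substAlgHom (R := k) hX.hasSubst) := by
  classical
  have hmem : ∀ j : Fin 3, ∃ c : Fin 3 → LocalRing3 k,
      ∑ i, c i * X i = MvPowerSeries.X j := by
    intro j
    have : (MvPowerSeries.X j : LocalRing3 k) ∈ Ideal.span (Set.range X) := by
      rw [hX, mem_maximalIdeal_iff, MvPowerSeries.constantCoeff_X]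
    exact (Ideal.mem_span_range_iff_exists_fun).mp this
  choose c hc using hmem
  -- `M` is the matrix of linear parts of the parameters and `N` its inverse. After composing with
  -- the linear substitution by `N`, the coordinate change is tangent to the identity.
  let N : Matrix (Fin 3) (Fin 3) k := fun j i => MvPowerSeries.constantCoeff (c j i)
  let M : Matrix (Fin 3) (Fin 3) k := fun i j => MvPowerSeries.coeff (Finsupp.single j 1) (X i)
  have hcoef : ∀ (j l i : Fin 3), MvPowerSeries.coeff (Finsupp.single l 1) (c j i * X i) =
      N j i * M i l := by
    intro j l i
    have h2 := MvPowerSeries.coeff_of_lt_order (d := Finsupp.single l 1) (lt_of_lt_of_le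
      (by rw [Finsupp.degree_single]; norm_num) (two_le_order_mul_sub (c := c j i)
        (hX.constantCoeff i)))
    rw [sub_mul, map_sub, sub_eq_zero] at h2
    rw [h2, MvPowerSeries.coeff_C_mul]
  have hNM : N * M = 1 := by
    ext j l
    rw [Matrix.mul_apply, ← Finset.sum_congr rfl fun i _ => hcoef j l i, ← map_sum, hc,
      MvPowerSeries.coeff_X, Matrix.one_apply]
    simp [Finsupp.single_left_inj, eq_comm]
  have hMN : M * N = 1 := mul_eq_one_comm.mp hNM
  let lin : Matrix (Fin 3) (Fin 3) k → Fin 3 → LocalRing3 k :=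
    fun A i => ∑ j, A i j • MvPowerSeries.X j
  have hlin : ∀ A, MvPowerSeries.HasSubst (lin A) := fun A =>
    MvPowerSeries.hasSubst_of_constantCoeff_zero fun i => by simp [lin]
  let L := MvPowerSeries.substAlgHom (R := k) (hlin N)
  let L' := MvPowerSeries.substAlgHom (R := k) (hlin M)
  let Φ := MvPowerSeries.substAlgHom (R := k) hX.hasSubst
  have hLL' : ∀ f, L (L' f) = f := by
    intro f
    have h1 : (fun i => MvPowerSeries.subst (lin N) (lin M i)) = MvPowerSeries.X := by
      funext i
      have : MvPowerSeries.subst (lin N) (lin M i) = L (lin M i) :=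
        (MvPowerSeries.substAlgHom_apply (hlin N) _).symm
      rw [this, map_sum]
      simp only [map_smul, L, MvPowerSeries.substAlgHom_X]
      simp only [lin, Finset.smul_sum, smul_smul]
      rw [Finset.sum_comm]
      simp only [← Finset.sum_smul, ← Matrix.mul_apply, hMN, Matrix.one_apply, ite_smul, one_smul,
        zero_smul, Finset.sum_ite_eq, Finset.mem_univ, if_true]
    have h2 := MvPowerSeries.subst_comp_subst_apply (hlin M) (hlin N) f
    rw [h1, MvPowerSeries.subst_self] at h2
    rw [← MvPowerSeries.substAlgHom_apply (hlin N), ← MvPowerSeries.substAlgHom_apply (hlin M)] at h2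
    exact h2
  have hΨ := bijective_of_order_sub (Φ.comp L) (by
    intro j
    have h1 : Φ.comp L (MvPowerSeries.X j) = ∑ i, N j i • X i := by
      rw [AlgHom.comp_apply]
      simp only [L, MvPowerSeries.substAlgHom_X, lin, map_sum, map_smul, Φ]
    rw [h1, ← hc j, ← Finset.sum_sub_distrib]
    refine le_order_sum _ _ fun i _ => ?_
    have h2 : N j i • X i - c j i * X i =
        -((c j i - MvPowerSeries.C (MvPowerSeries.constantCoeff (c j i))) * X i) := by
      rw [sub_mul, MvPowerSeries.smul_eq_C_mul]
      ring
    rw [h2, MvPowerSeries.order_neg]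
    exact two_le_order_mul_sub (hX.constantCoeff i))
  have hLsurj : Function.Surjective L := fun f => ⟨L' f, hLL' f⟩
  constructor
  · rw [injective_iff_map_eq_zero]
    intro f hf
    obtain ⟨g, rfl⟩ := hLsurj f
    have : g = 0 := (injective_iff_map_eq_zero (Φ.comp L)).mp hΨ.1 g hf
    rw [this, map_zero]
  · intro f
    obtain ⟨g, hg⟩ := hΨ.2 f
    exact ⟨L g, hg⟩

/-- The automorphism `F ↦ F(x, y, z)` attached to a regular system of parameters. -/
def IsParameterSystem.equiv {X : Fin 3 → LocalRing3 k} (hX : IsParameterSystem X) :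
    LocalRing3 k ≃ₐ[k] LocalRing3 k :=
  AlgEquiv.ofBijective _ hX.bijective

theorem IsParameterSystem.equiv_apply {X : Fin 3 → LocalRing3 k} (hX : IsParameterSystem X)
    (F : LocalRing3 k) : hX.equiv F = eval3 X F := by
  change MvPowerSeries.substAlgHom hX.hasSubst F = _
  rw [MvPowerSeries.substAlgHom_apply hX.hasSubst]
  rfl

theorem IsParameterSystem.equiv_X {X : Fin 3 → LocalRing3 k} (hX : IsParameterSystem X)
    (i : Fin 3) : hX.equiv (MvPowerSeries.X i) = X i :=
  MvPowerSeries.substAlgHom_X hX.hasSubst i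

/-! ### Separating z from (x, y); Weierstrass division and expansions in h -/

/-- The inclusion `k[[x, y]] → k[[x, y, z]]`. -/
def emb : MvPowerSeries (Fin 2) k →ₐ[k] LocalRing3 k :=
  MvPowerSeries.rename (Fin.castSuccEmb : Fin 2 ↪ Fin 3)

/-- The exponents of `x` and `y` in a monomial in `x`, `y`, `z`. -/
def xyPart (m : Fin 3 →₀ ℕ) : Fin 2 →₀ ℕ :=
  m.comapDomain Fin.castSucc (Fin.castSucc_injective 2).injOn

@[simp]
theorem xyPart_zero (m : Fin 3 →₀ ℕ) : xyPart m 0 = m 0 := rfl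

@[simp]
theorem xyPart_one (m : Fin 3 →₀ ℕ) : xyPart m 1 = m 1 := rfl

/-- The monomial `x^(n 0) y^(n 1) z^j`. -/
def joinZ (n : Fin 2 →₀ ℕ) (j : ℕ) : Fin 3 →₀ ℕ :=
  Finsupp.embDomain Fin.castSuccEmb n + Finsupp.single 2 j

theorem embDomain_castSucc_apply (n : Fin 2 →₀ ℕ) (i : Fin 2) :
    Finsupp.embDomain Fin.castSuccEmb n i.castSucc = n i :=
  Finsupp.embDomain_apply_self Fin.castSuccEmb n i

theorem embDomain_castSucc_two (n : Fin 2 →₀ ℕ) :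
    Finsupp.embDomain Fin.castSuccEmb n (2 : Fin 3) = 0 :=
  Finsupp.embDomain_of_notMem_range _ _ _ (by rintro ⟨i, hi⟩; fin_cases i <;> cases hi)

@[simp]
theorem joinZ_zero (n : Fin 2 →₀ ℕ) (j : ℕ) : joinZ n j 0 = n 0 := by
  rw [joinZ, Finsupp.add_apply, Finsupp.single_eq_of_ne (by decide), add_zero]
  exact embDomain_castSucc_apply n 0

@[simp]
theorem joinZ_one (n : Fin 2 →₀ ℕ) (j : ℕ) : joinZ n j 1 = n 1 := by
  rw [joinZ, Finsupp.add_apply, Finsupp.single_eq_of_ne (by decide), add_zero]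
  exact embDomain_castSucc_apply n 1

@[simp]
theorem joinZ_two (n : Fin 2 →₀ ℕ) (j : ℕ) : joinZ n j 2 = j := by
  rw [joinZ, Finsupp.add_apply, Finsupp.single_eq_same, embDomain_castSucc_two, zero_add]

@[simp]
theorem xyPart_joinZ (n : Fin 2 →₀ ℕ) (j : ℕ) : xyPart (joinZ n j) = n := by
  ext i; fin_cases i <;> simp

theorem joinZ_xyPart (m : Fin 3 →₀ ℕ) : joinZ (xyPart m) (m 2) = m := by
  ext i; fin_cases i <;> simp

theorem coeff_emb (F : MvPowerSeries (Fin 2) k) (m : Fin 3 →₀ ℕ) :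
    MvPowerSeries.coeff m (emb F) = if m 2 = 0 then MvPowerSeries.coeff (xyPart m) F else 0 := by
  split_ifs with h
  · conv_lhs => rw [← joinZ_xyPart m, h, joinZ, Finsupp.single_zero, add_zero]
    exact MvPowerSeries.coeff_embDomain_rename _ _ _
  · refine MvPowerSeries.coeff_rename_eq_zero _ _ ?_
    rintro ⟨n, hn⟩
    rw [← Finsupp.embDomain_eq_mapDomain] at hn
    rw [← hn, embDomain_castSucc_two] at h
    exact h rfl

theorem coeff_mul_X_two_pow (F : LocalRing3 k) (j : ℕ) (m : Fin 3 →₀ ℕ) :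
    MvPowerSeries.coeff m (F * MvPowerSeries.X 2 ^ j) =
      if j ≤ m 2 then MvPowerSeries.coeff (joinZ (xyPart m) (m 2 - j)) F else 0 := by
  have h : m - Finsupp.single 2 j = joinZ (xyPart m) (m 2 - j) := by
    ext i; fin_cases i <;> simp
  rw [MvPowerSeries.X_pow_eq, MvPowerSeries.coeff_mul_monomial, mul_one, h]
  simp only [Finsupp.single_le_iff]

theorem coeff_emb_mul_X_two_pow (F : MvPowerSeries (Fin 2) k) (j : ℕ) (m : Fin 3 →₀ ℕ) :
    MvPowerSeries.coeff m (emb F * MvPowerSeries.X 2 ^ j) =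
      if m 2 = j then MvPowerSeries.coeff (xyPart m) F else 0 := by
  rw [coeff_mul_X_two_pow, coeff_emb]
  simp only [joinZ_two, xyPart_joinZ]
  split_ifs <;> first | rfl | omega

/-- The coefficient of `z^j`, as a power series in `x` and `y`. -/
def zCoeff (j : ℕ) (f : LocalRing3 k) : MvPowerSeries (Fin 2) k :=
  fun n => MvPowerSeries.coeff (joinZ n j) f

theorem coeff_zCoeff (j : ℕ) (f : LocalRing3 k) (n : Fin 2 →₀ ℕ) :
    MvPowerSeries.coeff n (zCoeff j f) = MvPowerSeries.coeff (joinZ n j) f := rfl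

/-- The part of a power series of degree less than `q` in `z`. -/
def lowPart (q : ℕ) (f : LocalRing3 k) : LocalRing3 k :=
  ∑ j ∈ Finset.range q, emb (zCoeff j f) * MvPowerSeries.X 2 ^ j

theorem coeff_lowPart (q : ℕ) (f : LocalRing3 k) (m : Fin 3 →₀ ℕ) :
    MvPowerSeries.coeff m (lowPart q f) = if m 2 < q then MvPowerSeries.coeff m f else 0 := by
  rw [lowPart, map_sum]
  simp only [coeff_emb_mul_X_two_pow, Finset.sum_ite_eq, Finset.mem_range]
  split_ifs
  · rw [coeff_zCoeff, joinZ_xyPart]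
  · rfl

/-- The quotient of a power series by `z^q`. -/
def highPart (q : ℕ) : LocalRing3 k →+ LocalRing3 k where
  toFun f := fun m => MvPowerSeries.coeff (m + Finsupp.single 2 q) f
  map_zero' := rfl
  map_add' _ _ := rfl

theorem coeff_highPart (q : ℕ) (f : LocalRing3 k) (m : Fin 3 →₀ ℕ) :
    MvPowerSeries.coeff m (highPart q f) = MvPowerSeries.coeff (m + Finsupp.single 2 q) f := rfl

theorem lowPart_add_highPart_mul (q : ℕ) (f : LocalRing3 k) :
    lowPart q f + highPart q f * MvPowerSeries.X 2 ^ q = f := by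
  ext m
  rw [map_add, coeff_lowPart, coeff_mul_X_two_pow, coeff_highPart]
  split_ifs with h1 h2
  · omega
  · rw [add_zero]
  · rw [zero_add]
    congr 2
    ext i; fin_cases i <;> simp; omega
  · omega

/-- Weierstrass division by `z^q + A`, where `A` vanishes along `x = y = 0`. -/
theorem exists_weierstrass_division (q : ℕ) {A : LocalRing3 k}
    (hA : ∀ m : Fin 3 →₀ ℕ, m 0 + m 1 < 1 → MvPowerSeries.coeff m A = 0) (f : LocalRing3 k) :
    ∃ g, f = lowPart q g + (MvPowerSeries.X 2 ^ q + A) * highPart q g := by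
  classical
  -- Since g = low + z^q · high, the equation f = g + A · high is the division of f by z^q + A.
  -- Multiplication by A raises the degree in (x, y).
  let T : LocalRing3 k →+ LocalRing3 k := (AddMonoidHom.mulLeft A).comp (highPart q)
  have hT : RaisesWeight (fun m : Fin 3 →₀ ℕ => m 0 + m 1) T := by
    intro n g hg m hm
    change m 0 + m 1 < n + 1 at hm
    change MvPowerSeries.coeff m (A * highPart q g) = 0
    rw [MvPowerSeries.coeff_mul]
    refine Finset.sum_eq_zero fun ij hij => ?_
    rw [Finset.HasAntidiagonal.mem_antidiagonal] at hij
    by_cases h : ij.1 0 + ij.1 1 < 1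
    · rw [hA _ h, zero_mul]
    · rw [coeff_highPart, hg, mul_zero]
      have h0 := DFunLike.congr_fun hij 0
      have h1 := DFunLike.congr_fun hij 1
      simp only [Finsupp.add_apply] at h0 h1
      simp
      omega
  obtain ⟨g, hg⟩ := hT.surjective f
  refine ⟨g, ?_⟩
  rw [← hg]
  nth_rewrite 1 [← lowPart_add_highPart_mul q g]
  change _ + A * highPart q g = _
  ring

/-- The polynomial `z^q + a_1 z^(q-1) + ⋯ + a_q` in the standard coordinates. -/
def stdPoly (q : ℕ) (a : ℕ → MvPowerSeries (Fin 2) k) : LocalRing3 k :=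
  MvPowerSeries.X 2 ^ q +
    ∑ i ∈ Finset.Icc 1 q, emb (a i) * MvPowerSeries.X 2 ^ (q - i)

theorem coeff_stdPoly_of_gt (q : ℕ) (a : ℕ → MvPowerSeries (Fin 2) k) {m : Fin 3 →₀ ℕ}
    (hm : q < m 2) : MvPowerSeries.coeff m (stdPoly q a) = 0 := by
  rw [stdPoly, map_add, map_sum, ← one_mul (MvPowerSeries.X 2 ^ q), ← map_one emb,
    coeff_emb_mul_X_two_pow, if_neg (by omega), zero_add]
  refine Finset.sum_eq_zero fun i _ => ?_
  rw [coeff_emb_mul_X_two_pow, if_neg (by omega)]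

theorem coeff_stdPoly_of_eq (q : ℕ) (a : ℕ → MvPowerSeries (Fin 2) k) :
    MvPowerSeries.coeff (Finsupp.single 2 q) (stdPoly q a) = 1 := by
  classical
  have h : xyPart (Finsupp.single 2 q) = 0 := by ext i; fin_cases i <;> simp
  rw [stdPoly, map_add, map_sum, ← one_mul (MvPowerSeries.X 2 ^ q), ← map_one emb,
    coeff_emb_mul_X_two_pow, if_pos (by simp), h, MvPowerSeries.coeff_zero_one,
    Finset.sum_eq_zero, add_zero]
  intro i hi
  rw [Finset.mem_Icc] at hi
  rw [coeff_emb_mul_X_two_pow, if_neg]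
  rw [Finsupp.single_eq_same]; omega

theorem coeff_stdPoly_of_lt (q : ℕ) (a : ℕ → MvPowerSeries (Fin 2) k) {m : Fin 3 →₀ ℕ}
    (hm : m 2 < q) : MvPowerSeries.coeff m (stdPoly q a) =
      MvPowerSeries.coeff (xyPart m) (a (q - m 2)) := by
  rw [stdPoly, map_add, map_sum, ← one_mul (MvPowerSeries.X 2 ^ q), ← map_one emb,
    coeff_emb_mul_X_two_pow, if_neg (by omega), zero_add, Finset.sum_eq_single (q - m 2)]
  · rw [coeff_emb_mul_X_two_pow, if_pos (by omega)]
  · intro i hi hne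
    rw [Finset.mem_Icc] at hi
    rw [coeff_emb_mul_X_two_pow, if_neg (by omega)]
  · intro h
    exact (h (Finset.mem_Icc.mpr (by omega))).elim

theorem coeff_hasseZ (n : ℕ) (F : LocalRing3 k) (m : Fin 3 →₀ ℕ) :
    MvPowerSeries.coeff m (hasseZ n F) =
      ((m 2 + n).choose n : k) * MvPowerSeries.coeff (m + Finsupp.single 2 n) F := rfl

theorem lowPart_hasseZ_stdPoly (q : ℕ) (a : ℕ → MvPowerSeries (Fin 2) k) {n : ℕ} (hn : 0 < n) :
    lowPart q (hasseZ n (stdPoly q a)) = hasseZ n (stdPoly q a) := by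
  ext m
  rw [coeff_lowPart]
  split_ifs with h
  · rfl
  · rw [coeff_hasseZ, coeff_stdPoly_of_gt, mul_zero]
    simp
    omega

theorem coeff_hasseZ_stdPoly {q i : ℕ} (hi : 0 < i) (hiq : i ≤ q)
    (a : ℕ → MvPowerSeries (Fin 2) k) (n : Fin 2 →₀ ℕ) :
    MvPowerSeries.coeff (joinZ n 0) (hasseZ (q - i) (stdPoly q a)) =
      MvPowerSeries.coeff n (a i) := by
  have h : joinZ n 0 + Finsupp.single 2 (q - i) = joinZ n (q - i) := by
    rw [joinZ, joinZ, Finsupp.single_zero, add_zero]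
  rw [coeff_hasseZ, h, coeff_stdPoly_of_lt, joinZ_two, joinZ_two, xyPart_joinZ,
    Nat.sub_sub_self hiq, zero_add, Nat.choose_self, Nat.cast_one, one_mul]
  rw [joinZ_two]; omega

section Parameters

variable {X : Fin 3 → LocalRing3 k} (hX : IsParameterSystem X)

theorem IsParameterSystem.eval2_eq (F : MvPowerSeries (Fin 2) k) :
    eval2 X F = hX.equiv (emb F) := by
  rw [hX.equiv_apply, eval3, emb, MvPowerSeries.rename_eq_subst,
    MvPowerSeries.subst_comp_subst_apply (MvPowerSeries.HasSubst.X_comp _) hX.hasSubst, eval2]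
  congr 1
  funext i
  rw [Function.comp_apply, MvPowerSeries.subst_X hX.hasSubst]
  fin_cases i <;> rfl

theorem IsParameterSystem.equiv_stdPoly (q : ℕ) (a : ℕ → MvPowerSeries (Fin 2) k) :
    hX.equiv (stdPoly q a) = X 2 ^ q +
      ∑ i ∈ Finset.Icc 1 q, eval2 X (a i) * X 2 ^ (q - i) := by
  simp only [stdPoly, map_add, map_sum, map_mul, map_pow, hX.equiv_X, hX.eval2_eq]

theorem IsParameterSystem.equiv_lowPart (q : ℕ) (f : LocalRing3 k) :
    ∃ B : ℕ → MvPowerSeries (Fin 2) k,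
      hX.equiv (lowPart q f) = ∑ j ∈ Finset.range q, eval2 X (B j) * X 2 ^ j :=
  ⟨fun j => zCoeff j f, by
    simp only [lowPart, map_sum, map_mul, map_pow, hX.equiv_X, hX.eval2_eq]⟩

theorem IsParameterSystem.exists_division {q : ℕ} {a : ℕ → MvPowerSeries (Fin 2) k}
    (ha : ∀ i ∈ Finset.Icc 1 q, MvPowerSeries.constantCoeff (a i) = 0) (f : LocalRing3 k) :
    ∃ c f₁, (∃ B : ℕ → MvPowerSeries (Fin 2) k,
      c = ∑ j ∈ Finset.range q, eval2 X (B j) * X 2 ^ j) ∧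
      f = c + hX.equiv (stdPoly q a) * f₁ := by
  obtain ⟨g, hg⟩ := exists_weierstrass_division q
    (A := ∑ i ∈ Finset.Icc 1 q, emb (a i) * MvPowerSeries.X 2 ^ (q - i)) (by
      intro m hm
      rw [map_sum]
      refine Finset.sum_eq_zero fun i hi => ?_
      rw [coeff_emb_mul_X_two_pow]
      split_ifs
      · have : xyPart m = 0 := by ext i; fin_cases i <;> simp <;> omega
        rw [this, MvPowerSeries.coeff_zero_eq_constantCoeff_apply, ha i hi]
      · rfl) (hX.equiv.symm f)
  refine ⟨hX.equiv (lowPart q g), hX.equiv (highPart q g), hX.equiv_lowPart q g, ?_⟩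
  rw [← map_mul, ← map_add, stdPoly, ← hg, AlgEquiv.apply_symm_apply]

/-- Iterating the division on the quotient extends any given remainder `c` to a full expansion. The
divisibility condition on c_0 then applies to every division with remainder, with no appeal to
uniqueness. -/
theorem IsParameterSystem.exists_isExpansion {q : ℕ} {a : ℕ → MvPowerSeries (Fin 2) k}
    (ha : ∀ i ∈ Finset.Icc 1 q, MvPowerSeries.constantCoeff (a i) = 0)
    (hh : hX.equiv (stdPoly q a) ∈ maxIdeal k) {f c f₁ : LocalRing3 k}
    (hc : ∃ B : ℕ → MvPowerSeries (Fin 2) k,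
      c = ∑ j ∈ Finset.range q, eval2 X (B j) * X 2 ^ j)
    (hf : f = c + hX.equiv (stdPoly q a) * f₁) :
    ∃ C, IsExpansion X q (hX.equiv (stdPoly q a)) f C ∧ C 0 = c := by
  set h := hX.equiv (stdPoly q a)
  choose r s hr hrs using hX.exists_division ha
  let G : ℕ → LocalRing3 k := fun n => Nat.rec f₁ (fun _ g => s g) n
  let C : ℕ → LocalRing3 k := fun n => Nat.casesOn n c (fun b => r (G b))
  have hG : ∀ N, f - ∑ b ∈ Finset.range (N + 1), C b * h ^ b = h ^ (N + 1) * G N := by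
    intro N
    induction N with
    | zero =>
      rw [zero_add, Finset.sum_range_one, pow_zero, mul_one, pow_one, hf]
      change c + h * f₁ - c = h * f₁
      ring
    | succ N ih =>
      rw [Finset.sum_range_succ, ← sub_sub, ih]
      nth_rewrite 1 [hrs (G N)]
      change h ^ (N + 1) * (r (G N) + h * s (G N)) - r (G N) * h ^ (N + 1) =
        h ^ (N + 1 + 1) * s (G N)
      ring
  refine ⟨C, ⟨?_, ?_⟩, rfl⟩
  · intro b
    cases b with
    | zero => exact hc
    | succ b => exact hr (G b)
  · intro N
    cases N with
    | zero => rw [pow_zero, Ideal.one_eq_top]; exact Submodule.mem_top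
    | succ N =>
      rw [hG]
      exact Ideal.mul_mem_right _ _ (Ideal.pow_mem_pow hh _)

end Parameters

/-! ### Orders, restriction to the z-axis, and the ideal (x, h) -/

instance {σ : Type*} : IsDomain (MvPowerSeries σ k) :=
  NoZeroDivisors.to_isDomain _

theorem X_ne_zero {σ : Type*} (i : σ) : (MvPowerSeries.X i : MvPowerSeries σ k) ≠ 0 := by
  classical
  intro h
  have := congrArg (MvPowerSeries.coeff (Finsupp.single i 1)) h
  rw [MvPowerSeries.coeff_X, if_pos rfl, map_zero] at this
  exact one_ne_zero this

theorem le_order_algHom {σ τ : Type*} [Fintype σ]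
    (ψ : MvPowerSeries σ k →ₐ[k] MvPowerSeries τ k) (n : ℕ) :
    ∀ f : MvPowerSeries σ k, (n : ℕ∞) ≤ f.order → (n : ℕ∞) ≤ (ψ f).order := by
  induction n with
  | zero => intro f _; exact zero_le
  | succ n ih =>
    intro f hf
    obtain ⟨F, hF, rfl⟩ := exists_eq_sum_X_mul hf
    rw [map_sum]
    refine le_order_sum _ _ fun i _ => ?_
    rw [map_mul, add_comm]
    refine le_order_mul_of_le ?_ (ih _ (hF i))
    rw [Nat.cast_one, MvPowerSeries.one_le_order_iff_constCoeff_eq_zero, constantCoeff_algHom,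
      MvPowerSeries.constantCoeff_X]

theorem le_order_stdPoly {q : ℕ} {a : ℕ → MvPowerSeries (Fin 2) k}
    (ha : ∀ i ∈ Finset.Icc 1 q, (i : ℕ∞) < (a i).order) : (q : ℕ∞) ≤ (stdPoly q a).order := by
  refine MvPowerSeries.nat_le_order fun m hm => ?_
  rw [Finsupp.degree_eq_sum, Fin.sum_univ_three] at hm
  rw [coeff_stdPoly_of_lt q a (by omega)]
  refine MvPowerSeries.coeff_of_lt_order (lt_trans ?_
    (ha (q - m 2) (Finset.mem_Icc.mpr (by omega))))
  rw [Finsupp.degree_eq_sum, Fin.sum_univ_two, xyPart_zero, xyPart_one]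
  exact_mod_cast (by omega : m 0 + m 1 < q - m 2)

theorem X_dvd_of_X_dvd_X_mul {σ : Type*} {i j : σ} (hij : i ≠ j) {f : MvPowerSeries σ k}
    (h : MvPowerSeries.X i ∣ MvPowerSeries.X j * f) : MvPowerSeries.X i ∣ f := by
  rw [MvPowerSeries.X_dvd_iff] at h ⊢
  intro m hm
  have := h (Finsupp.single j 1 + m) (by
    rw [Finsupp.add_apply, hm, Finsupp.single_eq_of_ne hij])
  rwa [MvPowerSeries.X_def, MvPowerSeries.coeff_add_monomial_mul, one_mul] at this

theorem eq_X_mul_add_X_mul {f : LocalRing3 k}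
    (hf : ∀ n, MvPowerSeries.coeff (Finsupp.single 2 n) f = 0) :
    ∃ u v, f = MvPowerSeries.X 0 * u + MvPowerSeries.X 1 * v := by
  classical
  let g : LocalRing3 k := fun m => if m 0 = 0 then MvPowerSeries.coeff m f else 0
  have hg : ∀ m, MvPowerSeries.coeff m g = if m 0 = 0 then MvPowerSeries.coeff m f else 0 :=
    fun m => rfl
  have h0 : MvPowerSeries.X 0 ∣ f - g := by
    rw [MvPowerSeries.X_dvd_iff]
    intro m hm
    rw [map_sub, hg, if_pos hm, sub_self]
  have h1 : MvPowerSeries.X 1 ∣ g := by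
    rw [MvPowerSeries.X_dvd_iff]
    intro m hm
    rw [hg]
    split_ifs with h
    · have : m = Finsupp.single 2 (m 2) := by ext i; fin_cases i <;> simp [hm, h]
      rw [this, hf]
    · rfl
  obtain ⟨u, hu⟩ := h0
  obtain ⟨v, hv⟩ := h1
  exact ⟨u, v, by rw [← hu, ← hv, sub_add_cancel]⟩

/-- The restriction to the `z`-axis. -/
def restrictZ : LocalRing3 k →ₐ[k] PowerSeries k :=
  MvPowerSeries.killCompl (Function.Embedding.punit (2 : Fin 3))

theorem coeff_restrictZ (f : LocalRing3 k) (n : ℕ) :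
    PowerSeries.coeff n (restrictZ f) = MvPowerSeries.coeff (Finsupp.single 2 n) f := by
  rw [PowerSeries.coeff, restrictZ, MvPowerSeries.coeff_killCompl, Finsupp.embDomain_single]
  rfl

theorem restrictZ_emb (F : MvPowerSeries (Fin 2) k) (hF : MvPowerSeries.constantCoeff F = 0) :
    restrictZ (emb F) = 0 := by
  ext n
  rw [coeff_restrictZ, coeff_emb]
  have h : xyPart (Finsupp.single 2 n) = 0 := by ext i; fin_cases i <;> simp
  rw [h, MvPowerSeries.coeff_zero_eq_constantCoeff_apply, hF, ite_self, map_zero]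

theorem restrictZ_X_two : restrictZ (MvPowerSeries.X 2 : LocalRing3 k) = PowerSeries.X :=
  MvPowerSeries.killCompl_X (e := Function.Embedding.punit (2 : Fin 3)) PUnit.unit

theorem restrictZ_stdPoly {q : ℕ} {a : ℕ → MvPowerSeries (Fin 2) k}
    (ha : ∀ i ∈ Finset.Icc 1 q, MvPowerSeries.constantCoeff (a i) = 0) :
    restrictZ (stdPoly q a) = PowerSeries.X ^ q := by
  rw [stdPoly, map_add, map_sum, map_pow, restrictZ_X_two, Finset.sum_eq_zero, add_zero]
  intro i hi
  rw [map_mul, restrictZ_emb _ (ha i hi), zero_mul]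

/-- No power of `y` lies in the ideal generated by `x` and `z^q + a_1 z^(q-1) + ⋯ + a_q`. -/
theorem X_one_pow_ne {q : ℕ} (hq : 0 < q) {a : ℕ → MvPowerSeries (Fin 2) k}
    (ha : ∀ i ∈ Finset.Icc 1 q, MvPowerSeries.constantCoeff (a i) = 0) (b : ℕ) :
    ∀ t f : LocalRing3 k, MvPowerSeries.X 1 ^ b ≠ MvPowerSeries.X 0 * t + stdPoly q a * f := by
  induction b with
  | zero =>
    intro t f h
    have := congrArg MvPowerSeries.constantCoeff h
    rw [pow_zero, map_one, map_add, map_mul, map_mul, MvPowerSeries.constantCoeff_X, zero_mul,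
      zero_add] at this
    have h2 : MvPowerSeries.constantCoeff (stdPoly q a) = 0 := by
      rw [← MvPowerSeries.coeff_zero_eq_constantCoeff_apply, coeff_stdPoly_of_lt q a (by simpa)]
      have h : xyPart 0 = 0 := by ext i; fin_cases i <;> simp
      rw [h, MvPowerSeries.coeff_zero_eq_constantCoeff_apply]
      exact ha _ (Finset.mem_Icc.mpr (by simp; omega))
    rw [h2, zero_mul] at this
    exact one_ne_zero this
  | succ b ih =>
    intro t f h
    have h1 := congrArg restrictZ h
    have hX : ∀ i : Fin 2, restrictZ (MvPowerSeries.X i.castSucc : LocalRing3 k) = 0 := fun i =>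
      MvPowerSeries.killCompl_X_eq_zero (by rintro ⟨j, hj⟩; fin_cases i <;> cases hj)
    have hX0 : restrictZ (MvPowerSeries.X 0 : LocalRing3 k) = 0 := hX 0
    have hX1 : restrictZ (MvPowerSeries.X 1 : LocalRing3 k) = 0 := hX 1
    -- On the z-axis the relation becomes 0 = z^q f, so f = xu + yv. Cancelling y modulo x then
    -- lowers the exponent from b + 1 to b.
    rw [map_pow, hX1, map_add, map_mul, map_mul, hX0, restrictZ_stdPoly ha,
      zero_pow (Nat.succ_ne_zero b), zero_mul, zero_add, eq_comm, mul_eq_zero] at h1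
    have h2 : restrictZ f = 0 := h1.resolve_left (pow_ne_zero _ PowerSeries.X_ne_zero)
    obtain ⟨u, v, rfl⟩ := eq_X_mul_add_X_mul (f := f) (fun n => by
      rw [← coeff_restrictZ, h2, map_zero])
    obtain ⟨w, hw⟩ := X_dvd_of_X_dvd_X_mul (i := (0 : Fin 3)) (j := 1) (by decide)
      (f := MvPowerSeries.X 1 ^ b - stdPoly q a * v) ⟨t + stdPoly q a * u, by
        linear_combination h⟩
    exact ih w v (by rw [← hw]; ring)

theorem IsParameterSystem.not_dvd {X : Fin 3 → LocalRing3 k} (hX : IsParameterSystem X) :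
    ¬ X 0 ∣ X 1 := by
  classical
  intro h
  have h1 := map_dvd hX.equiv.symm h
  rw [← hX.equiv_X, ← hX.equiv_X, AlgEquiv.symm_apply_apply, AlgEquiv.symm_apply_apply,
    MvPowerSeries.X_dvd_iff] at h1
  have h2 := h1 (Finsupp.single 1 1) (by simp)
  rw [MvPowerSeries.coeff_X, if_pos rfl] at h2
  exact one_ne_zero h2

/-! ### Divisibility by x and comparison of two choices -/

namespace Situation

variable {p e : ℕ} {R : IdealisticFiltration k} {E : Set (Ideal (LocalRing3 k))}
  {D : Ideal (LocalRing3 k)}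

theorem constantCoeff_coeff (S : Situation p e R E D) :
    ∀ i ∈ Finset.Icc 1 (p ^ e), MvPowerSeries.constantCoeff (S.coeff i) = 0 := by
  intro i hi
  rw [← MvPowerSeries.one_le_order_iff_constCoeff_eq_zero]
  refine le_trans ?_ (S.order_coeff i hi).le
  exact_mod_cast (Finset.mem_Icc.mp hi).1

theorem equiv_stdPoly (S : Situation p e R E D) :
    S.isParameterSystem.equiv (stdPoly (p ^ e) S.coeff) = S.h := by
  rw [S.isParameterSystem.equiv_stdPoly, ← S.h_eq]

theorem le_order_h (S : Situation p e R E D) : ((p ^ e : ℕ) : ℕ∞) ≤ S.h.order := by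
  rw [← S.equiv_stdPoly]
  exact le_order_algHom (S.isParameterSystem.equiv : LocalRing3 k →ₐ[k] LocalRing3 k) _ _
    (le_order_stdPoly S.order_coeff)

theorem associated_X_zero (S₀ S : Situation p e R E D) : Associated (S.X 0) (S₀.X 0) := by
  rw [← Ideal.span_singleton_eq_span_singleton]
  exact S.H_x_eq.symm.trans S₀.H_x_eq

/-- The boundary `E` is common to both choices: either β = 0, or {y = 0} is the component other than
`H_x`, which fixes y up to a unit. -/
theorem exists_associated_pow (S₀ S : Situation p e R E D) :
    ∃ b, Associated (S.X 1 ^ S.β) (S₀.X 1 ^ b) := by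
  rcases S.boundary with ⟨-, hβ⟩ | hE
  · exact ⟨0, by rw [hβ, pow_zero, pow_zero]⟩
  · have hmem : Ideal.span {S.X 1} ∈ E := hE.ge (Or.inr rfl)
    have hne : Ideal.span {S.X 1} ≠ Ideal.span {S₀.X 0} := by
      intro h
      exact S.isParameterSystem.not_dvd (Ideal.mem_span_singleton.mp
        (((h.trans S₀.H_x_eq.symm).trans S.H_x_eq).le (Ideal.mem_span_singleton_self _)))
    refine ⟨S.β, Associated.pow_pow ?_⟩
    rw [← Ideal.span_singleton_eq_span_singleton]
    rcases S₀.boundary with ⟨hE₀, -⟩ | hE₀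
    · exact (hne (hE₀.le hmem)).elim
    · exact (hE₀.le hmem).resolve_left hne

/-- In the coordinates of `S` the coefficient of z^q in `S.h` is 1. The term `c` contributes
nothing, being divisible by x; a non-unit f₁ would give `S₀.h * f₁` order above q and leave nothing
at all. -/
theorem isUnit_of_eq (S₀ S : Situation p e R E D) {c f₁ : LocalRing3 k}
    (hc : S₀.X 0 ∣ c) (h : S.h = c + S₀.h * f₁) : IsUnit f₁ := by
  by_contra hu
  have hX := S.isParameterSystem
  have hf₁ : ((1 : ℕ) : ℕ∞) ≤ f₁.order := by
    rw [Nat.cast_one, MvPowerSeries.one_le_order_iff_constCoeff_eq_zero, ← mem_maximalIdeal_iff]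
    exact hu
  have hord := le_order_algHom (hX.equiv.symm : LocalRing3 k →ₐ[k] LocalRing3 k) _ _
    (le_order_mul_of_le S₀.le_order_h hf₁)
  have h1 := congrArg (fun f => MvPowerSeries.coeff (Finsupp.single 2 (p ^ e))
    (hX.equiv.symm f)) h
  rw [← S.equiv_stdPoly, AlgEquiv.symm_apply_apply, coeff_stdPoly_of_eq, map_add, map_add] at h1
  have h2 : MvPowerSeries.coeff (Finsupp.single 2 (p ^ e)) (hX.equiv.symm (S₀.h * f₁)) = 0 := by
    refine MvPowerSeries.coeff_of_lt_order (lt_of_lt_of_le ?_ hord)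
    rw [Finsupp.degree_single]
    exact_mod_cast Nat.lt_succ_self _
  have h3 : MvPowerSeries.coeff (Finsupp.single 2 (p ^ e)) (hX.equiv.symm c) = 0 := by
    have := map_dvd hX.equiv.symm ((associated_X_zero S₀ S).dvd.trans hc)
    rw [← hX.equiv_X, AlgEquiv.symm_apply_apply, MvPowerSeries.X_dvd_iff] at this
    exact this _ (by simp)
  rw [h2, h3, add_zero] at h1
  exact one_ne_zero h1

variable [hp : Fact p.Prime]

theorem h_mem_maxIdeal (S : Situation p e R E D) : S.h ∈ maxIdeal k := by
  rw [maxIdeal, mem_maximalIdeal_iff, ← MvPowerSeries.one_le_order_iff_constCoeff_eq_zero]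
  refine le_trans ?_ S.le_order_h
  exact_mod_cast Nat.one_le_pow _ _ hp.out.pos

theorem dvd_of_eq (S : Situation p e R E D) {n : ℕ} {f c f₁ : LocalRing3 k}
    (hf : f ∈ R.ideal n) (hc : ∃ B : ℕ → MvPowerSeries (Fin 2) k,
      c = ∑ j ∈ Finset.range (p ^ e), eval2 S.X (B j) * S.X 2 ^ j)
    (h : f = c + S.h * f₁) :
    S.X 0 ^ ⌈(S.α : ℚ) * n / S.a⌉₊ * S.X 1 ^ ⌈(S.β : ℚ) * n / S.a⌉₊ ∣ c := by
  have h0 := S.equiv_stdPoly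
  obtain ⟨C, hC, rfl⟩ := S.isParameterSystem.exists_isExpansion (f := f) (f₁ := f₁)
    S.constantCoeff_coeff (by rw [h0]; exact S.h_mem_maxIdeal) hc (by rw [h0]; exact h)
  rw [h0] at hC
  exact S.dvd_constantTerm n f hf C hC

theorem exists_reduction (S : Situation p e R E D) {n : ℕ} {f : LocalRing3 k}
    (hf : f ∈ R.ideal n) :
    ∃ c f₁, S.X 0 ^ ⌈(S.α : ℚ) * n / S.a⌉₊ ∣ c ∧ f = c + S.h * f₁ := by
  obtain ⟨c, f₁, hc, h⟩ := S.isParameterSystem.exists_division S.constantCoeff_coeff f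
  rw [S.equiv_stdPoly] at h
  exact ⟨c, f₁, (Dvd.intro _ rfl).trans (S.dvd_of_eq hf hc h), h⟩

/-- The divided derivative of h of order q - i lies at level i and has degree less than q in z, so
it is its own remainder modulo h. Its z-free part is exactly a_i, with binomial coefficient 1. -/
theorem X_pow_dvd_coeff (S : Situation p e R E D) {i : ℕ} (hi : 0 < i) (hiq : i < p ^ e) :
    MvPowerSeries.X 0 ^ ⌈(S.α : ℚ) * i / S.a⌉₊ ∣ S.coeff i := by
  have hX := S.isParameterSystem
  have hmem : hX.equiv (hasseZ (p ^ e - i) (stdPoly (p ^ e) S.coeff)) ∈ R.ideal i := by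
    have := S.isZSaturated (p ^ e - i) (p ^ e) (stdPoly (p ^ e) S.coeff) (by
      rw [← hX.equiv_apply, S.equiv_stdPoly]; exact S.h_mem)
    rwa [← hX.equiv_apply, Nat.sub_sub_self hiq.le] at this
  have hlow := hX.equiv_lowPart (p ^ e) (hasseZ (p ^ e - i) (stdPoly (p ^ e) S.coeff))
  rw [lowPart_hasseZ_stdPoly _ _ (by omega)] at hlow
  have h1 := map_dvd hX.equiv.symm ((Dvd.intro _ rfl).trans
    (S.dvd_of_eq (f₁ := 0) hmem hlow (by rw [mul_zero, add_zero])))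
  rw [AlgEquiv.symm_apply_apply, map_pow, ← hX.equiv_X, AlgEquiv.symm_apply_apply,
    MvPowerSeries.X_pow_dvd_iff] at h1
  rw [MvPowerSeries.X_pow_dvd_iff]
  intro n hn
  rw [← coeff_hasseZ_stdPoly hi hiq.le]
  exact h1 _ (by rwa [joinZ_zero])

/-- The multiplicity `α / a` of the monomial along `H_x` does not depend on the choices. -/
theorem mul_a_le (S₀ S : Situation p e R E D) : S₀.α * S.a ≤ S.α * S₀.a := by
  by_contra hlt
  have hX := S₀.isParameterSystem
  obtain ⟨b, hb⟩ := exists_associated_pow S₀ S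
  have hmem : S₀.X 0 ^ S.α * S₀.X 1 ^ b ∈ R.ideal S.a := by
    have hass := ((associated_X_zero S₀ S).pow_pow (n := S.α)).mul_mul hb
    exact (Ideal.mem_iff_of_associated hass).mp S.monomial_mem
  -- Multiplied by x^α, this division has a remainder of the required shape, because x^α lies in
  -- k[[x, y]]. If μ of `S` were smaller, x^(α+1) would divide x^α c, so x ∣ c and y^b would lie in
  -- (x, h).
  obtain ⟨c, f₁, ⟨B, hB⟩, h⟩ := hX.exists_division S₀.constantCoeff_coeff (S₀.X 1 ^ b)
  have hK : S.α + 1 ≤ ⌈(S₀.α : ℚ) * S.a / S₀.a⌉₊ := by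
    rw [Nat.succ_le_iff, Nat.lt_ceil, lt_div_iff₀ (by exact_mod_cast S₀.a_pos)]
    exact_mod_cast not_le.mp hlt
  have hdvd := S₀.dvd_of_eq (c := S₀.X 0 ^ S.α * c) (f₁ := S₀.X 0 ^ S.α * f₁) hmem
    ⟨fun j => MvPowerSeries.X 0 ^ S.α * B j, by
      have hx : emb (MvPowerSeries.X 0) = (MvPowerSeries.X 0 : LocalRing3 k) :=
        MvPowerSeries.rename_X _ _
      simp only [hB, hX.eval2_eq, map_mul, map_pow, Finset.mul_sum, hx, hX.equiv_X, mul_assoc]⟩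
    (by rw [← S₀.equiv_stdPoly]; nth_rewrite 1 [h]; ring)
  have hx0 : S₀.X 0 ≠ 0 := by
    rw [← hX.equiv_X, map_ne_zero_iff _ hX.equiv.injective]
    exact MonomialCase.X_ne_zero 0
  have hdvd' : S₀.X 0 ^ (S.α + 1) ∣ S₀.X 0 ^ S.α * c :=
    (pow_dvd_pow _ hK).trans ((Dvd.intro _ rfl).trans hdvd)
  rw [pow_succ, mul_dvd_mul_iff_left (pow_ne_zero _ hx0)] at hdvd'
  obtain ⟨t, rfl⟩ := hdvd'
  have h3 := congrArg hX.equiv.symm h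
  rw [map_pow, map_add, map_mul, map_mul, ← hX.equiv_X, ← hX.equiv_X,
    AlgEquiv.symm_apply_apply, AlgEquiv.symm_apply_apply, AlgEquiv.symm_apply_apply] at h3
  exact X_one_pow_ne (Nat.pow_pos hp.out.pos) S₀.constantCoeff_coeff b _ _ h3

end Situation

/-! ### q-th powers and residual order -/

section Frobenius

variable {p : ℕ} [hp : Fact p.Prime] [CharP k p] {σ : Type*}

theorem coeff_smul_pow (e : ℕ) (w : MvPowerSeries σ k) (n : σ →₀ ℕ) :
    MvPowerSeries.coeff (p ^ e • n) (w ^ p ^ e) = MvPowerSeries.coeff n w ^ p ^ e := by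
  have : ExpChar k p := ExpChar.prime hp.out
  rw [← MvPowerSeries.map_iterateFrobenius_expand p hp.out.ne_zero, MvPowerSeries.coeff_map,
    MvPowerSeries.coeff_expand_smul, iterateFrobenius_def]

theorem coeff_pow_of_not_dvd (e : ℕ) (w : MvPowerSeries σ k) {m : σ →₀ ℕ} {i : σ}
    (h : ¬ p ^ e ∣ m i) : MvPowerSeries.coeff m (w ^ p ^ e) = 0 := by
  have : ExpChar k p := ExpChar.prime hp.out
  rw [← MvPowerSeries.map_iterateFrobenius_expand p hp.out.ne_zero, MvPowerSeries.coeff_map,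
    MvPowerSeries.coeff_expand_of_not_dvd _ _ _ h, map_zero]

theorem exists_smul_eq {q : ℕ} {m : σ →₀ ℕ} (h : ∀ i, q ∣ m i) : ∃ n : σ →₀ ℕ, q • n = m := by
  refine ⟨m.mapRange (fun n => n / q) (Nat.zero_div q), ?_⟩
  ext i
  exact Nat.mul_div_cancel' (h i)

variable [IsAlgClosed k]

/-- Coefficients have q-th roots since k is algebraically closed, and in characteristic p the q-th
power acts monomial by monomial. -/
theorem exists_pow_eq_of_forall_dvd (e : ℕ) {f : MvPowerSeries σ k}
    (hf : ∀ m, MvPowerSeries.coeff m f ≠ 0 → ∀ i, p ^ e ∣ m i) : ∃ w, f = w ^ p ^ e := by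
  have hpos : 0 < p ^ e := Nat.pow_pos hp.out.pos
  have hroot : ∀ n : σ →₀ ℕ, ∃ c : k, c ^ p ^ e = MvPowerSeries.coeff (p ^ e • n) f := fun n =>
    IsAlgClosed.exists_pow_nat_eq _ hpos
  obtain ⟨w, hw⟩ : ∃ w : MvPowerSeries σ k, ∀ n,
      MvPowerSeries.coeff n w ^ p ^ e = MvPowerSeries.coeff (p ^ e • n) f :=
    ⟨fun n => (hroot n).choose, fun n => (hroot n).choose_spec⟩
  refine ⟨w, ?_⟩
  ext m
  by_cases h : ∀ i, p ^ e ∣ m i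
  · obtain ⟨n, rfl⟩ := exists_smul_eq h
    rw [coeff_smul_pow, ← hw]
  · push Not at h
    obtain ⟨i, hi⟩ := h
    rw [coeff_pow_of_not_dvd e w hi]
    by_contra hne
    exact hi (hf m hne i)

theorem monomial_eq_pow_iff (e : ℕ) {m : σ →₀ ℕ} {c : k} (hc : c ≠ 0) :
    (∃ w : MvPowerSeries σ k, MvPowerSeries.monomial m c = w ^ p ^ e) ↔ ∀ i, p ^ e ∣ m i := by
  classical
  constructor
  · rintro ⟨w, hw⟩ i
    by_contra hi
    have h := congrArg (MvPowerSeries.coeff m) hw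
    rw [coeff_pow_of_not_dvd e w hi, MvPowerSeries.coeff_monomial_same] at h
    exact hc h
  · intro h
    refine exists_pow_eq_of_forall_dvd e fun n hn => ?_
    rw [MvPowerSeries.coeff_monomial] at hn
    split_ifs at hn with hnm
    · rwa [hnm]
    · exact (hn rfl).elim

theorem resOrd_eq_sInf (e : ℕ) (f : MvPowerSeries σ k) : resOrd (p ^ e) f =
    sInf {d | ∃ m : σ →₀ ℕ, MvPowerSeries.coeff m f ≠ 0 ∧ (∃ i, ¬ p ^ e ∣ m i) ∧
      d = (m.degree : ℕ∞)} := by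
  rw [resOrd]
  congr 1
  ext d
  refine exists_congr fun m => and_congr_right fun hm => and_congr_left fun _ => ?_
  rw [monomial_eq_pow_iff e hm, not_forall]

theorem exists_pow_eq_of_resOrd_eq_top (e : ℕ) {f : MvPowerSeries σ k}
    (hf : resOrd (p ^ e) f = ⊤) : ∃ w, f = w ^ p ^ e := by
  rw [resOrd_eq_sInf, sInf_eq_top] at hf
  refine exists_pow_eq_of_forall_dvd e fun m hm i => ?_
  by_contra hi
  exact ENat.natCast_ne_top _ (hf _ ⟨m, hm, ⟨i, hi⟩, rfl⟩)

theorem resOrd_powerSeries (e : ℕ) (g : PowerSeries k) : resOrd (p ^ e) g =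
    sInf {d | ∃ n : ℕ, PowerSeries.coeff n g ≠ 0 ∧ ¬ p ^ e ∣ n ∧ d = (n : ℕ∞)} := by
  have := resOrd_eq_sInf (k := k) (p := p) (σ := Unit) e g
  rw [this]
  congr 1
  ext d
  constructor
  · rintro ⟨m, hm, ⟨i, hi⟩, rfl⟩
    have hm' : m = Finsupp.single () (m ()) := Finsupp.unique_ext (by simp)
    refine ⟨m (), ?_, hi, ?_⟩
    · rw [PowerSeries.coeff, ← hm']; exact hm
    · conv_lhs => rw [hm', Finsupp.degree_single]
  · rintro ⟨n, hn, hi, rfl⟩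
    exact ⟨Finsupp.single () n, hn, ⟨(), by rwa [Finsupp.single_eq_same]⟩, by
      rw [Finsupp.degree_single]⟩

/-- Below degree d only exponents divisible by q occur, so the truncation of g is a q-th power G^q;
the rest starts with a nonzero term in degree d. -/
theorem exists_of_resOrd_eq (e : ℕ) {g : PowerSeries k} {d : ℕ}
    (hd : resOrd (p ^ e) g = d) :
    ¬ p ^ e ∣ d ∧ PowerSeries.coeff d g ≠ 0 ∧
      ∃ G U : PowerSeries k, IsUnit U ∧ g = G ^ p ^ e + PowerSeries.X ^ d * U := by
  rw [resOrd_powerSeries] at hd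
  have hmem : (d : ℕ∞) ∈ {d : ℕ∞ | ∃ n : ℕ, PowerSeries.coeff n g ≠ 0 ∧ ¬ p ^ e ∣ n ∧
      d = (n : ℕ∞)} := by
    rw [← hd]
    refine csInf_mem ?_
    rw [Set.nonempty_iff_ne_empty]
    intro h
    rw [h, sInf_empty] at hd
    exact ENat.top_ne_natCast _ hd
  obtain ⟨n, hn, hndvd, hdn⟩ := hmem
  have hdn' : d = n := by exact_mod_cast hdn
  subst hdn'
  refine ⟨hndvd, hn, ?_⟩
  let low : PowerSeries k := PowerSeries.mk fun n => if n < d then PowerSeries.coeff n g else 0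
  have hlow : ∃ G : PowerSeries k, low = G ^ p ^ e := by
    refine exists_pow_eq_of_forall_dvd (σ := Unit) e fun m hm i => ?_
    by_contra hi
    have hm' : m = Finsupp.single () (m ()) := Finsupp.unique_ext (by simp)
    have hc : MvPowerSeries.coeff m low = if m () < d then PowerSeries.coeff (m ()) g else 0 := by
      rw [hm']
      exact (PowerSeries.coeff_mk _ _).trans (by simp)
    rw [hc] at hm
    split_ifs at hm with hlt
    · have hle : (d : ℕ∞) ≤ (m () : ℕ∞) := by
        rw [← hd]
        exact sInf_le ⟨m (), hm, hi, rfl⟩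
      exact absurd (by exact_mod_cast hle : d ≤ m ()) (not_le.mpr hlt)
    · exact hm rfl
  obtain ⟨G, hG⟩ := hlow
  have hX : PowerSeries.X ^ d ∣ g - low := by
    rw [PowerSeries.X_pow_dvd_iff]
    intro m hm
    rw [map_sub, PowerSeries.coeff_mk, if_pos hm, sub_self]
  obtain ⟨U, hU⟩ := hX
  refine ⟨G, U, ?_, ?_⟩
  · rw [PowerSeries.isUnit_iff_constantCoeff, isUnit_iff_ne_zero]
    have h1 := congrArg (PowerSeries.coeff d) hU
    rw [map_sub, PowerSeries.coeff_mk, if_neg (lt_irrefl d), sub_zero,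
      PowerSeries.coeff_X_pow_mul', if_pos le_rfl, Nat.sub_self,
      PowerSeries.coeff_zero_eq_constantCoeff_apply] at h1
    rwa [← h1]
  · rw [← hG, ← hU, add_sub_cancel]

end Frobenius

/-! ### Initial forms along x = 0 -/

theorem order_eq_sInf (g : PowerSeries k) :
    g.order = sInf {d | ∃ n : ℕ, PowerSeries.coeff n g ≠ 0 ∧ d = (n : ℕ∞)} := by
  refine le_antisymm (le_sInf ?_) ?_
  · rintro d ⟨n, hn, rfl⟩
    exact PowerSeries.order_le n hn
  · by_cases hg : g = 0
    · rw [hg, PowerSeries.order_zero]; exact le_top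
    · exact sInf_le ⟨_, PowerSeries.coeff_order hg, (PowerSeries.coe_toNat_order hg).symm⟩

/-- The restriction of a power series in `(x, y)` to `x = 0`. -/
def restrictY : MvPowerSeries (Fin 2) k →ₐ[k] PowerSeries k :=
  MvPowerSeries.killCompl (Function.Embedding.punit (1 : Fin 2))

theorem coeff_restrictY (f : MvPowerSeries (Fin 2) k) (n : ℕ) :
    PowerSeries.coeff n (restrictY f) = MvPowerSeries.coeff (Finsupp.single 1 n) f := by
  rw [PowerSeries.coeff, restrictY, MvPowerSeries.coeff_killCompl, Finsupp.embDomain_single]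
  rfl

theorem restrictY_X_zero : restrictY (MvPowerSeries.X 0 : MvPowerSeries (Fin 2) k) = 0 :=
  MvPowerSeries.killCompl_X_eq_zero (by rintro ⟨j, hj⟩; cases hj)

theorem restrictY_X_one :
    restrictY (MvPowerSeries.X 1 : MvPowerSeries (Fin 2) k) = PowerSeries.X :=
  MvPowerSeries.killCompl_X (e := Function.Embedding.punit (1 : Fin 2)) PUnit.unit

theorem restrictY_eq_zero_iff {f : MvPowerSeries (Fin 2) k} :
    restrictY f = 0 ↔ MvPowerSeries.X 0 ∣ f := by
  constructor
  · intro h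
    rw [MvPowerSeries.X_dvd_iff]
    intro m hm
    have : m = Finsupp.single 1 (m 1) := by ext i; fin_cases i <;> simp [hm]
    rw [this, ← coeff_restrictY, h, map_zero]
  · rintro ⟨u, rfl⟩
    rw [map_mul, restrictY_X_zero, zero_mul]

/-- The inclusion `k[[y]] → k[[x, y]]`. -/
def inclY : PowerSeries k →ₐ[k] MvPowerSeries (Fin 2) k :=
  MvPowerSeries.rename (Function.Embedding.punit (1 : Fin 2))

theorem inclY_eq (g : PowerSeries k) :
    PowerSeries.subst (MvPowerSeries.X 1 : MvPowerSeries (Fin 2) k) g = inclY g :=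
  (MvPowerSeries.rename_eq_subst _ _).symm

theorem restrictY_inclY (g : PowerSeries k) : restrictY (inclY g) = g :=
  MvPowerSeries.killCompl_rename_app _

theorem inclY_X : inclY (PowerSeries.X : PowerSeries k) = MvPowerSeries.X 1 :=
  MvPowerSeries.rename_X _ _

theorem coeff_inclY (g : PowerSeries k) (m : Fin 2 →₀ ℕ) :
    MvPowerSeries.coeff m (inclY g) = if m 0 = 0 then PowerSeries.coeff (m 1) g else 0 := by
  split_ifs with h
  · have : m = Finsupp.single 1 (m 1) := by ext i; fin_cases i <;> simp [h]
    conv_lhs => rw [this, ← coeff_restrictY, restrictY_inclY]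
  · refine MvPowerSeries.coeff_rename_eq_zero _ _ ?_
    rintro ⟨n, rfl⟩
    apply h
    rw [Finsupp.mapDomain_of_notMem_range]
    rintro ⟨j, hj⟩
    cases hj

theorem coeff_X_zero_pow_mul_inclY (r : ℕ) (g : PowerSeries k) (m : Fin 2 →₀ ℕ) :
    MvPowerSeries.coeff m (MvPowerSeries.X 0 ^ r * inclY g) =
      if m 0 = r then PowerSeries.coeff (m 1) g else 0 := by
  rw [MvPowerSeries.X_pow_eq, MvPowerSeries.coeff_monomial_mul, coeff_inclY, one_mul]
  simp only [Finsupp.single_le_iff]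
  simp only [Finsupp.coe_tsub, Pi.sub_apply, Finsupp.single_eq_same]
  rw [Finsupp.single_eq_of_ne (by decide)]
  split_ifs <;> first | rfl | omega

theorem ordX_eq_iff {f : MvPowerSeries (Fin 2) k} {r : ℕ} {g : PowerSeries k}
    {ω : MvPowerSeries (Fin 2) k}
    (hf : f = MvPowerSeries.X 0 ^ r * (inclY g + MvPowerSeries.X 0 * ω)) :
    ordX f = r ↔ g ≠ 0 := by
  rw [ordX, emultiplicity_eq_coe, and_iff_right (Dvd.intro _ hf.symm), hf, pow_succ,
    mul_dvd_mul_iff_left (pow_ne_zero _ (X_ne_zero 0)), ← restrictY_eq_zero_iff, map_add, map_mul,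
    restrictY_inclY, restrictY_X_zero, zero_mul, add_zero]

theorem exists_eq_of_ordX {f : MvPowerSeries (Fin 2) k} {r : ℕ} (hr : ordX f = r) :
    ∃ g ω, f = MvPowerSeries.X 0 ^ r * (inclY g + MvPowerSeries.X 0 * ω) := by
  obtain ⟨u, rfl⟩ := (emultiplicity_eq_coe.mp hr).1
  obtain ⟨ω, hω⟩ := restrictY_eq_zero_iff.mp (show restrictY (u - inclY (restrictY u)) = 0 by
    rw [map_sub, restrictY_inclY, sub_self])
  exact ⟨restrictY u, ω, by rw [← hω, add_sub_cancel]⟩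

theorem initX_eq {f : MvPowerSeries (Fin 2) k} {r : ℕ} {g : PowerSeries k}
    {ω : MvPowerSeries (Fin 2) k} (hr : ordX f = r)
    (hf : f = MvPowerSeries.X 0 ^ r * (inclY g + MvPowerSeries.X 0 * ω)) :
    initX f = MvPowerSeries.X 0 ^ r * inclY g := by
  ext m
  rw [coeff_X_zero_pow_mul_inclY]
  change (if (m 0 : ℕ∞) = ordX f then MvPowerSeries.coeff m f else 0) = _
  rw [hr]
  by_cases h : m 0 = r
  · rw [if_pos (by rw [h]), if_pos h, hf, mul_add, map_add, coeff_X_zero_pow_mul_inclY, if_pos h,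
      ← mul_assoc, ← pow_succ, MvPowerSeries.X_pow_dvd_iff.mp (Dvd.intro _ rfl) m (by omega),
      add_zero]
  · rw [if_neg (by exact_mod_cast h), if_neg h]

theorem sInf_add_image (r : ℕ) (A : Set ℕ∞) : sInf ((fun d => (r : ℕ∞) + d) '' A) = r + sInf A := by
  refine le_antisymm ?_ (le_sInf ?_)
  · rcases A.eq_empty_or_nonempty with rfl | hA
    · rw [Set.image_empty, sInf_empty, add_top]
    · exact sInf_le ⟨_, csInf_mem hA, rfl⟩
  · rintro _ ⟨d, hd, rfl⟩
    exact add_le_add le_rfl (sInf_le hd)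

/-- A term in x^r y^n is a q-th power exactly when q divides both r and n. If q ∤ r, every term of g
counts, which is why the order replaces the residual order. -/
theorem resOrd_X_zero_pow_mul {p : ℕ} [Fact p.Prime] [CharP k p] [IsAlgClosed k] (e r : ℕ)
    (g : PowerSeries k) : resOrd (p ^ e) (MvPowerSeries.X 0 ^ r * inclY g) =
      r + (if p ^ e ∣ r then resOrd (p ^ e) g else g.order) := by
  have h : (if p ^ e ∣ r then resOrd (p ^ e) g else g.order) =
      sInf {d | ∃ n : ℕ, PowerSeries.coeff n g ≠ 0 ∧ (¬ p ^ e ∣ r ∨ ¬ p ^ e ∣ n) ∧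
        d = (n : ℕ∞)} := by
    split_ifs with hr
    · rw [resOrd_powerSeries]
      simp only [hr, not_true_eq_false, false_or]
    · rw [order_eq_sInf]
      simp only [hr, not_false_eq_true, true_or, true_and]
  rw [h, ← sInf_add_image, resOrd_eq_sInf]
  congr 1
  ext d
  have hdeg : ∀ m : Fin 2 →₀ ℕ, m.degree = m 0 + m 1 := fun m => by
    rw [Finsupp.degree_eq_sum, Fin.sum_univ_two]
  constructor
  · rintro ⟨m, hm, ⟨i, hi⟩, rfl⟩
    rw [coeff_X_zero_pow_mul_inclY] at hm
    split_ifs at hm with hmr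
    · refine ⟨_, ⟨m 1, hm, ?_, rfl⟩, ?_⟩
      · fin_cases i
        · exact Or.inl (by rwa [← hmr])
        · exact Or.inr hi
      · rw [hdeg, hmr]; push_cast; rfl
    · exact (hm rfl).elim
  · rintro ⟨_, ⟨n, hn, hi, rfl⟩, rfl⟩
    have h0 : (Finsupp.single 0 r + Finsupp.single 1 n : Fin 2 →₀ ℕ) 0 = r := by simp
    have h1 : (Finsupp.single 0 r + Finsupp.single 1 n : Fin 2 →₀ ℕ) 1 = n := by simp
    refine ⟨Finsupp.single 0 r + Finsupp.single 1 n, ?_, ?_, ?_⟩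
    · rwa [coeff_X_zero_pow_mul_inclY, if_pos h0, h1]
    · rcases hi with hi | hi
      · exact ⟨0, by rwa [h0]⟩
      · exact ⟨1, by rwa [h1]⟩
    · rw [hdeg, h0, h1]; push_cast; rfl

theorem X_pow_dvd_algHom {σ : Type*} [Fintype σ] (ψ : MvPowerSeries σ k →ₐ[k] PowerSeries k)
    {n : ℕ} {f : MvPowerSeries σ k} (hf : (n : ℕ∞) ≤ f.order) : PowerSeries.X ^ n ∣ ψ f := by
  have h := le_order_algHom (τ := Unit) ψ n f hf
  rw [PowerSeries.X_pow_dvd_iff]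
  intro m hm
  refine MvPowerSeries.coeff_of_lt_order (lt_of_lt_of_le ?_ h)
  rw [Finsupp.degree_single]
  exact_mod_cast hm

theorem X_dvd_algHom {σ : Type*} [Fintype σ] (ψ : MvPowerSeries σ k →ₐ[k] PowerSeries k)
    {f : MvPowerSeries σ k} (hf : MvPowerSeries.constantCoeff f = 0) : PowerSeries.X ∣ ψ f := by
  rw [← pow_one PowerSeries.X]
  refine X_pow_dvd_algHom ψ ?_
  rw [Nat.cast_one, MvPowerSeries.one_le_order_iff_constCoeff_eq_zero, hf]

/-! ### The lexicographic filtration and the Newton polygon of h -/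

/-- `F` lies in the ideal `(x^(i+1), x^i y^j)`. -/
def LexDvd (i j : ℕ) (F : MvPowerSeries (Fin 2) k) : Prop :=
  ∃ w, F = MvPowerSeries.X 0 ^ i * w ∧ PowerSeries.X ^ j ∣ restrictY w

theorem LexDvd.of_dvd {i : ℕ} (j : ℕ) {F : MvPowerSeries (Fin 2) k}
    (h : MvPowerSeries.X 0 ^ (i + 1) ∣ F) : LexDvd i j F := by
  obtain ⟨u, rfl⟩ := h
  refine ⟨MvPowerSeries.X 0 * u, by rw [pow_succ, mul_assoc], ?_⟩
  rw [map_mul, restrictY_X_zero, zero_mul]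
  exact dvd_zero _

theorem LexDvd.add {i j : ℕ} {F G : MvPowerSeries (Fin 2) k} (hF : LexDvd i j F)
    (hG : LexDvd i j G) : LexDvd i j (F + G) := by
  obtain ⟨u, rfl, hu⟩ := hF
  obtain ⟨v, rfl, hv⟩ := hG
  exact ⟨u + v, by rw [mul_add], by rw [map_add]; exact dvd_add hu hv⟩

theorem LexDvd.mul_right {i j : ℕ} {F : MvPowerSeries (Fin 2) k} (hF : LexDvd i j F)
    (G : MvPowerSeries (Fin 2) k) : LexDvd i j (F * G) := by
  obtain ⟨u, rfl, hu⟩ := hF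
  exact ⟨u * G, by rw [mul_assoc], by rw [map_mul]; exact hu.mul_right _⟩

theorem LexDvd.mono {i j i' j' : ℕ} {F : MvPowerSeries (Fin 2) k} (hF : LexDvd i j F)
    (h : i' < i ∨ i' = i ∧ j' ≤ j) : LexDvd i' j' F := by
  rcases h with h | ⟨rfl, h⟩
  · obtain ⟨u, rfl, -⟩ := hF
    exact LexDvd.of_dvd _ ((pow_dvd_pow _ h).trans (Dvd.intro _ rfl))
  · obtain ⟨u, rfl, hu⟩ := hF
    exact ⟨u, rfl, (pow_dvd_pow _ h).trans hu⟩

theorem exists_ceil_div (r : ℕ) {q : ℕ} (hq : 0 < q) :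
    ∃ s, r ≤ s * q ∧ ∀ m < s, m * q < r := by
  have h : ∃ s, r ≤ s * q := ⟨r, Nat.le_mul_of_pos_right r hq⟩
  classical
  exact ⟨Nat.find h, Nat.find_spec h, fun m hm => not_le.mp (Nat.find_min h hm)⟩

/-- The terms of `f^q + c_1 f^(q-1) + ⋯ + c_q` strictly between the first and the last one. -/
theorem X_zero_pow_dvd_sum {q n m : ℕ} {c : ℕ → MvPowerSeries (Fin 2) k}
    {φ : MvPowerSeries (Fin 2) k} {K : ℕ → ℕ} (hφ : MvPowerSeries.X 0 ^ m ∣ φ)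
    (hc : ∀ i, 0 < i → i < q → MvPowerSeries.X 0 ^ K i ∣ c i)
    (hK : ∀ i, 0 < i → i < q → n ≤ K i + m * (q - i)) :
    MvPowerSeries.X 0 ^ n ∣ ∑ i ∈ Finset.Ico 1 q, c i * φ ^ (q - i) := by
  refine Finset.dvd_sum fun i hi => ?_
  rw [Finset.mem_Ico] at hi
  refine (pow_dvd_pow _ (hK i (by omega) hi.2)).trans ?_
  rw [pow_add, pow_mul]
  exact mul_dvd_mul (hc i (by omega) hi.2) (pow_dvd_pow_of_dvd hφ _)

/-- If `x^r` divides `f^q + c_1 f^(q-1) + ⋯ + c_q` and the `c_i` are sufficiently divisible by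
`x`, then `x^s` divides `f` for `s = ⌈r/q⌉`. -/
theorem X_zero_pow_dvd_of_dvd {q r : ℕ} {c : ℕ → MvPowerSeries (Fin 2) k}
    {φ : MvPowerSeries (Fin 2) k} {K : ℕ → ℕ}
    (hc : ∀ i, 0 < i → i < q → MvPowerSeries.X 0 ^ K i ∣ c i)
    (hK : ∀ i, 0 < i → i < q → r * i < K i * q) (hcq : MvPowerSeries.X 0 ^ r ∣ c q)
    (h : MvPowerSeries.X 0 ^ r ∣ φ ^ q + ∑ i ∈ Finset.Ico 1 q, c i * φ ^ (q - i) + c q)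
    {s : ℕ} (hs : ∀ m < s, m * q < r) : MvPowerSeries.X 0 ^ s ∣ φ := by
  induction s with
  | zero => exact one_dvd _
  | succ s ih =>
    have hsr := hs s (Nat.lt_succ_self s)
    have hφ := ih fun m hm => hs m (Nat.lt_succ_of_lt hm)
    have hmid := X_zero_pow_dvd_sum (n := s * q + 1) hφ hc (by
      intro i hi hiq
      have h1 := hK i hi hiq
      -- The a_i lie above the segment of slope r/q, and s < r/q. The middle terms thus vanish to
      -- order sq + 1, forcing the same on φ^q and so one more factor x in φ.
      have h2 : s * i < K i := by
        by_contra hle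
        have h3 : K i * q ≤ s * i * q := Nat.mul_le_mul_right q (not_lt.mp hle)
        have h4 : s * q * i ≤ r * i := Nat.mul_le_mul_right i hsr.le
        have h5 : s * i * q = s * q * i := by ring
        omega
      have h6 : s * q = s * i + s * (q - i) := by rw [← mul_add]; congr 1; omega
      omega)
    have h1 : MvPowerSeries.X 0 ^ (s * q + 1) ∣ φ ^ q := by
      have h2 := (pow_dvd_pow _ hsr).trans h
      rw [add_assoc] at h2
      exact (dvd_add_left (dvd_add hmid ((pow_dvd_pow _ hsr).trans hcq))).mp h2
    obtain ⟨u, rfl⟩ := hφ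
    rw [mul_pow, ← pow_mul, pow_succ, mul_dvd_mul_iff_left (pow_ne_zero _ (X_ne_zero 0)),
      ← restrictY_eq_zero_iff, map_pow] at h1
    rw [pow_succ]
    exact mul_dvd_mul_left _ (restrictY_eq_zero_iff.mp (pow_eq_zero_iff (n := q) (by rintro rfl; simp at h1) |>.mp h1))

section Leading

variable {p : ℕ} [hp : Fact p.Prime] [CharP k p]

/-- The normal form of the coefficient `g` of `x^r` in `a_q`: removing the `q`-th powers which can
be absorbed by a change of `z` leaves a series of order `d`. -/
def IsLeadingForm (q r d : ℕ) (g G : PowerSeries k) : Prop :=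
  ∃ U, IsUnit U ∧ g = G ^ q + PowerSeries.X ^ d * U ∧ (¬ q ∣ r ∧ G = 0 ∨ q ∣ r ∧ ¬ q ∣ d)

theorem coeff_pow_add_ne_zero (e : ℕ) {d : ℕ} {F W : PowerSeries k} (hW : IsUnit W)
    (hF : F = 0 ∨ ¬ p ^ e ∣ d) :
    PowerSeries.coeff d (F ^ p ^ e + PowerSeries.X ^ d * W) ≠ 0 := by
  have h1 : PowerSeries.coeff d (F ^ p ^ e) = 0 := by
    rcases hF with rfl | hd
    · rw [zero_pow (pow_ne_zero _ hp.out.ne_zero), map_zero]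
    · exact coeff_pow_of_not_dvd (σ := Unit) e F (i := ()) (by rwa [Finsupp.single_eq_same])
  rw [map_add, h1, zero_add, PowerSeries.coeff_X_pow_mul', if_pos le_rfl, Nat.sub_self,
    PowerSeries.coeff_zero_eq_constantCoeff_apply]
  exact isUnit_iff_ne_zero.mp (PowerSeries.isUnit_iff_constantCoeff.mp hW)

theorem IsLeadingForm.coeff_ne_zero {e r d : ℕ} {g G : PowerSeries k}
    (h : IsLeadingForm (p ^ e) r d g G) : PowerSeries.coeff d g ≠ 0 := by
  obtain ⟨U, hU, rfl, hG⟩ := h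
  exact coeff_pow_add_ne_zero e hU (hG.imp (fun h => h.2) fun h => h.2)

theorem not_lexDvd_of_isLeadingForm {e r d : ℕ} {c : ℕ → MvPowerSeries (Fin 2) k}
    {φ : MvPowerSeries (Fin 2) k} {K : ℕ → ℕ} {g G : PowerSeries k}
    {v w : MvPowerSeries (Fin 2) k} {θ : PowerSeries k →ₐ[k] PowerSeries k}
    (hc : ∀ i, 0 < i → i < p ^ e → MvPowerSeries.X 0 ^ K i ∣ c i)
    (hK : ∀ i, 0 < i → i < p ^ e → r * i < K i * p ^ e)
    (hcq : c (p ^ e) = MvPowerSeries.X 0 ^ r * (v ^ r * w))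
    (hv : IsUnit v) (hw : restrictY w = θ g)
    (hθ : ∃ u, IsUnit u ∧ θ PowerSeries.X = PowerSeries.X * u)
    (hg : IsLeadingForm (p ^ e) r d g G) :
    ¬ LexDvd r (d + 1) (φ ^ p ^ e +
      ∑ i ∈ Finset.Ico 1 (p ^ e), c i * φ ^ (p ^ e - i) + c (p ^ e)) := by
  rintro ⟨w', hw', hdvd⟩
  obtain ⟨u, hu, hθu⟩ := hθ
  obtain ⟨U, hU, rfl, hG⟩ := hg
  have hq : 0 < p ^ e := Nat.pow_pos hp.out.pos
  obtain ⟨s, hrs, hs⟩ := exists_ceil_div r hq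
  have hφ := X_zero_pow_dvd_of_dvd hc hK (Dvd.intro _ hcq.symm) (Dvd.intro _ hw'.symm) hs
  -- With s = ⌈r/q⌉, strictness in `hK` kills all middle terms modulo x^(r+1). Only φ^q and c_q
  -- remain in the coefficient of x^r.
  obtain ⟨t, ht⟩ := X_zero_pow_dvd_sum (n := r + 1) hφ hc (by
    intro i hi hiq
    have h1 := hK i hi hiq
    have h2 : r * (p ^ e - i) ≤ s * p ^ e * (p ^ e - i) := Nat.mul_le_mul_right _ hrs
    have h3 : r * p ^ e = r * i + r * (p ^ e - i) := by rw [← mul_add]; congr 1; omega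
    have h4 : (K i + s * (p ^ e - i)) * p ^ e = K i * p ^ e + s * p ^ e * (p ^ e - i) := by ring
    have h5 : r * p ^ e < (K i + s * (p ^ e - i)) * p ^ e := by omega
    exact Nat.lt_of_mul_lt_mul_right h5)
  obtain ⟨φ', rfl⟩ := hφ
  have hv0 : IsUnit (restrictY v) := hv.map restrictY
  have hkey : ∃ F W : PowerSeries k, IsUnit W ∧ (F = 0 ∨ ¬ p ^ e ∣ d) ∧
      restrictY w' = F ^ p ^ e + PowerSeries.X ^ d * W := by
    rw [ht, hcq] at hw'
    have hX := pow_ne_zero r (X_ne_zero (k := k) (0 : Fin 2))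
    rcases hG with ⟨hqr, rfl⟩ | ⟨hqr, hqd⟩
    · refine ⟨0, restrictY v ^ r * (u ^ d * θ U), (hv0.pow r).mul ((hu.pow d).mul (hU.map θ)),
        Or.inl rfl, ?_⟩
      -- As q ∤ r, the power φ^q already vanishes modulo x^(r+1).
      have hlt : r + 1 ≤ s * p ^ e := by
        rcases hrs.eq_or_lt with h | h
        · exact (hqr ⟨s, h.trans (mul_comm _ _)⟩).elim
        · exact h
      obtain ⟨j, hj⟩ := Nat.exists_eq_add_of_le hlt
      have h1 : w' = MvPowerSeries.X 0 * (MvPowerSeries.X 0 ^ j * φ' ^ p ^ e + t) + v ^ r * w := by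
        apply mul_left_cancel₀ hX
        rw [← hw', mul_pow, ← pow_mul, hj]
        ring
      rw [h1, map_add, map_mul, restrictY_X_zero, zero_mul, zero_add, map_mul, map_pow, hw,
        map_add, map_mul, map_pow, map_pow, hθu, map_zero, mul_pow]
      rw [zero_pow hq.ne']
      ring
    · have hrs' : r = s * p ^ e := by
        obtain ⟨j, rfl⟩ := hqr
        refine le_antisymm hrs ?_
        by_contra hlt
        have hjs : j < s := by
          rw [not_le, mul_comm] at hlt
          exact Nat.lt_of_mul_lt_mul_right hlt
        have := hs j hjs
        rw [mul_comm] at this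
        omega
      -- Here r = sq, so v^r θ(G)^q is itself a q-th power, and Frobenius merges it with the
      -- contribution of φ^q.
      refine ⟨restrictY φ' + restrictY v ^ s * θ G, restrictY v ^ r * (u ^ d * θ U),
        (hv0.pow r).mul ((hu.pow d).mul (hU.map θ)), Or.inr hqd, ?_⟩
      have h1 : w' = φ' ^ p ^ e + MvPowerSeries.X 0 * t + v ^ r * w := by
        apply mul_left_cancel₀ hX
        rw [← hw', mul_pow, ← pow_mul, ← hrs']
        ring
      have hch : ∀ a b : PowerSeries k, (a + b) ^ p ^ e = a ^ p ^ e + b ^ p ^ e := fun a b => by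
        have : CharP (PowerSeries k) p :=
          charP_of_injective_algebraMap (algebraMap k (PowerSeries k)).injective p
        exact add_pow_char_pow a b p e
      rw [h1, hch, map_add, map_add, map_mul, restrictY_X_zero, zero_mul, add_zero, map_mul,
        map_pow, map_pow, hw, map_add, map_mul, map_pow, map_pow, hθu, mul_pow, mul_pow,
        ← pow_mul, ← hrs']
      ring
  obtain ⟨F, W, hW, hF, h⟩ := hkey
  rw [h, PowerSeries.X_pow_dvd_iff] at hdvd
  exact coeff_pow_add_ne_zero e hW hF (hdvd d (Nat.lt_succ_self d))

/-- The substitution cancels G^q against the q-th power of φ. When q ∤ r one has G = 0, hence φ = 0,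
and the rounding in r / q is harmless. -/
theorem lexDvd_of_isLeadingForm {e r d : ℕ} {c : ℕ → MvPowerSeries (Fin 2) k}
    {K : ℕ → ℕ} {g G : PowerSeries k} {ω : MvPowerSeries (Fin 2) k}
    (hc : ∀ i, 0 < i → i < p ^ e → MvPowerSeries.X 0 ^ K i ∣ c i)
    (hK : ∀ i, 0 < i → i < p ^ e → r * i < K i * p ^ e)
    (hcq : c (p ^ e) = MvPowerSeries.X 0 ^ r * (inclY g + MvPowerSeries.X 0 * ω))
    (hg : IsLeadingForm (p ^ e) r d g G) {φ : MvPowerSeries (Fin 2) k}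
    (hφ : φ = - (MvPowerSeries.X 0 ^ (r / p ^ e) * inclY G)) :
    LexDvd r d (φ ^ p ^ e +
      ∑ i ∈ Finset.Ico 1 (p ^ e), c i * φ ^ (p ^ e - i) + c (p ^ e)) := by
  have hq : 0 < p ^ e := Nat.pow_pos hp.out.pos
  obtain ⟨U, hU, rfl, hG⟩ := hg
  -- Derived from additivity of Frobenius, so that p = 2 needs no separate treatment.
  have hneg : ∀ a : MvPowerSeries (Fin 2) k, (-a) ^ p ^ e = - a ^ p ^ e := fun a => by
    have : CharP (MvPowerSeries (Fin 2) k) p :=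
      charP_of_injective_algebraMap (algebraMap k (MvPowerSeries (Fin 2) k)).injective p
    rw [eq_neg_iff_add_eq_zero, ← add_pow_char_pow, neg_add_cancel, zero_pow hq.ne']
  have hlast : φ ^ p ^ e + c (p ^ e) = MvPowerSeries.X 0 ^ r *
      (inclY (PowerSeries.X ^ d * U) + MvPowerSeries.X 0 * ω) := by
    rw [hφ, hneg, hcq, mul_pow, map_add, map_pow]
    rcases hG with ⟨-, rfl⟩ | ⟨hqr, -⟩
    · rw [map_zero, zero_pow hq.ne']; ring
    · rw [← pow_mul, Nat.div_mul_cancel hqr]; ring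
  have hmid : MvPowerSeries.X 0 ^ (r + 1) ∣
      ∑ i ∈ Finset.Ico 1 (p ^ e), c i * φ ^ (p ^ e - i) := by
    rcases hG with ⟨-, rfl⟩ | ⟨hqr, -⟩
    · rw [Finset.sum_eq_zero]
      · exact dvd_zero _
      · intro i hi
        rw [Finset.mem_Ico] at hi
        rw [hφ, map_zero, mul_zero, neg_zero, zero_pow (by omega), mul_zero]
    · obtain ⟨j, rfl⟩ := hqr
      rw [Nat.mul_div_cancel_left j hq] at hφ
      refine X_zero_pow_dvd_sum (m := j) (hφ ▸ (dvd_neg.mpr (Dvd.intro _ rfl))) hc ?_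
      intro i hi hiq
      have h1 := hK i hi hiq
      have h2 : j * i < K i := by
        have : j * i * p ^ e < K i * p ^ e := by
          calc j * i * p ^ e = p ^ e * j * i := by ring
            _ < _ := h1
        exact Nat.lt_of_mul_lt_mul_right this
      have h3 : p ^ e * j = j * i + j * (p ^ e - i) := by
        rw [← mul_add, mul_comm]; congr 1; omega
      omega
  rw [add_right_comm, hlast]
  refine LexDvd.add ⟨_, rfl, ?_⟩ (LexDvd.of_dvd _ hmid)
  rw [map_add, restrictY_inclY, map_mul, restrictY_X_zero, zero_mul, add_zero]
  exact Dvd.intro _ rfl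

end Leading

/-! ### Transversal sections -/

namespace Situation

variable {p e : ℕ} {R : IdealisticFiltration k} {E : Set (Ideal (LocalRing3 k))}
  {D : Ideal (LocalRing3 k)}

/-- A transversal section `O → k[[x, y]]`: it preserves `H_x`, it is tangent to `z = 0`
along `H_x`, and it is of maximal rank. -/
structure IsSection (S : Situation p e R E D)
    (π : LocalRing3 k →ₐ[k] MvPowerSeries (Fin 2) k) : Prop where
  associated : Associated (π (S.X 0)) (MvPowerSeries.X 0)
  pow_dvd_h : PowerSeries.X ^ (p ^ e + 1) ∣ restrictY (π S.h)
  exists_not_dvd : ∃ f, MvPowerSeries.constantCoeff f = 0 ∧ ¬ PowerSeries.X ^ 2 ∣ restrictY (π f)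

variable {π : LocalRing3 k →ₐ[k] MvPowerSeries (Fin 2) k} {S : Situation p e R E D}

theorem IsSection.restrictY_X_zero (hπ : S.IsSection π) : restrictY (π (S.X 0)) = 0 :=
  restrictY_eq_zero_iff.mpr hπ.associated.symm.dvd

theorem IsSection.X_pow_dvd (hπ : S.IsSection π) {n : ℕ} {f : LocalRing3 k}
    (h : S.X 0 ^ n ∣ f) : MvPowerSeries.X 0 ^ n ∣ π f := by
  refine (pow_dvd_pow_of_dvd hπ.associated.symm.dvd n).trans ?_
  rw [← map_pow]
  exact map_dvd π h

/-- Sections do not depend on the choice of `h` and `(x, y, z)`. -/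
theorem IsSection.of_eq {S₀ : Situation p e R E D} (hπ : S₀.IsSection π) {c f₁ : LocalRing3 k}
    (hc : S₀.X 0 ∣ c) (h : S.h = c + S₀.h * f₁) : S.IsSection π := by
  refine ⟨((associated_X_zero S₀ S).map π).trans hπ.associated, ?_, hπ.exists_not_dvd⟩
  have h0 : restrictY (π c) = 0 := by
    rw [restrictY_eq_zero_iff, ← pow_one (MvPowerSeries.X 0)]
    exact hπ.X_pow_dvd (by rwa [pow_one])
  rw [h, map_add, map_add, h0, zero_add, map_mul, map_mul]
  exact hπ.pow_dvd_h.mul_right _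

/-- Since ord a_i > i, h agrees with z^q up to order q + 1. Thus y^(q+1) divides the q-th power of
the restriction of z, whose order must then be at least 2. This is the tangency encoded by the
condition on h. -/
theorem IsSection.dvd_restrictY_X_two (hπ : S.IsSection π) :
    PowerSeries.X ^ 2 ∣ restrictY (π (S.X 2)) := by
  have hX := S.isParameterSystem
  let τ : LocalRing3 k →ₐ[k] PowerSeries k := restrictY.comp π
  obtain ⟨u, hu⟩ := X_dvd_algHom τ (hX.constantCoeff 2)
  have h1 : ((p ^ e + 1 : ℕ) : ℕ∞) ≤
      (stdPoly (p ^ e) S.coeff - MvPowerSeries.X 2 ^ p ^ e).order := by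
    rw [stdPoly, add_sub_cancel_left]
    refine le_order_sum _ _ fun i hi => ?_
    have h2 := le_order_algHom emb (i + 1) (S.coeff i)
      (by push_cast; exact Order.add_one_le_of_lt (S.order_coeff i hi))
    have h3 : ((p ^ e - i : ℕ) : ℕ∞) ≤
        (MvPowerSeries.X 2 ^ (p ^ e - i) : LocalRing3 k).order :=
      MvPowerSeries.le_order_pow_of_constantCoeff_eq_zero _ (MvPowerSeries.constantCoeff_X _)
    have h4 := le_order_mul_of_le h2 h3
    rw [Finset.mem_Icc] at hi
    rwa [show i + 1 + (p ^ e - i) = p ^ e + 1 by omega] at h4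
  have h2 := X_pow_dvd_algHom (τ.comp (hX.equiv : LocalRing3 k →ₐ[k] LocalRing3 k)) h1
  have h3 : (τ.comp (hX.equiv : LocalRing3 k →ₐ[k] LocalRing3 k))
      (stdPoly (p ^ e) S.coeff - MvPowerSeries.X 2 ^ p ^ e) =
      restrictY (π S.h) - τ (S.X 2) ^ p ^ e := by
    change τ (hX.equiv _) = _
    rw [map_sub, map_sub, S.equiv_stdPoly, map_pow, map_pow, hX.equiv_X]
    rfl
  rw [h3, dvd_sub_right hπ.pow_dvd_h, hu, mul_pow, pow_succ,
    mul_dvd_mul_iff_left (pow_ne_zero _ PowerSeries.X_ne_zero)] at h2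
  obtain ⟨v, rfl⟩ := PowerSeries.X_prime.dvd_of_dvd_pow h2
  change PowerSeries.X ^ 2 ∣ τ (S.X 2)
  rw [hu, pow_two, ← mul_assoc]
  exact Dvd.intro _ rfl

/-- x restricts to 0 and z to order at least 2, so y is the only parameter that can account for an
element of order 1. Hence π reparametrizes the y-line. -/
theorem IsSection.restrictY_X_one (hπ : S.IsSection π) :
    ∃ u, IsUnit u ∧ restrictY (π (S.X 1)) = PowerSeries.X * u := by
  have hX := S.isParameterSystem
  let τ : LocalRing3 k →ₐ[k] PowerSeries k := restrictY.comp π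
  obtain ⟨u, hu⟩ := X_dvd_algHom τ (hX.constantCoeff 1)
  refine ⟨u, ?_, hu⟩
  rw [PowerSeries.isUnit_iff_constantCoeff, isUnit_iff_ne_zero]
  intro h0
  obtain ⟨v, rfl⟩ := PowerSeries.X_dvd_iff.mpr h0
  obtain ⟨f, hf, hnot⟩ := hπ.exists_not_dvd
  have hmem : f ∈ Ideal.span (Set.range S.X) := by
    rw [hX]; exact mem_maximalIdeal_iff.mpr hf
  obtain ⟨c, rfl⟩ := Ideal.mem_span_range_iff_exists_fun.mp hmem
  apply hnot
  have h1 : restrictY (π (S.X 1)) = PowerSeries.X ^ 2 * v := by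
    rw [pow_two, mul_assoc]; exact hu
  rw [Fin.sum_univ_three, map_add, map_add, map_add, map_add, map_mul, map_mul, map_mul, map_mul,
    map_mul, map_mul, hπ.restrictY_X_zero, mul_zero, zero_add, h1]
  exact dvd_add ((Dvd.intro _ rfl).mul_left _) (hπ.dvd_restrictY_X_two.mul_left _)

theorem map_h (S : Situation p e R E D) (π : LocalRing3 k →ₐ[k] MvPowerSeries (Fin 2) k)
    (hq : 0 < p ^ e) : π S.h = π (S.X 2) ^ p ^ e +
      ∑ i ∈ Finset.Ico 1 (p ^ e), π (eval2 S.X (S.coeff i)) * π (S.X 2) ^ (p ^ e - i) +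
      π (eval2 S.X (S.coeff (p ^ e))) := by
  rw [S.h_eq, ← Finset.Ico_insert_right hq, Finset.sum_insert Finset.right_notMem_Ico]
  simp only [map_add, map_sum, map_mul, map_pow, Nat.sub_self, pow_zero, mul_one]
  ring

theorem hasSubst_section {φ : MvPowerSeries (Fin 2) k}
    (hφ : MvPowerSeries.constantCoeff φ = 0) :
    MvPowerSeries.HasSubst (S := k) ![MvPowerSeries.X 0, MvPowerSeries.X 1, φ] :=
  MvPowerSeries.hasSubst_of_constantCoeff_zero fun i => by fin_cases i <;> simp [hφ]

/-- The section `x ↦ x`, `y ↦ y`, `z ↦ φ(x, y)`. -/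
def sectionMap (S : Situation p e R E D) {φ : MvPowerSeries (Fin 2) k}
    (hφ : MvPowerSeries.constantCoeff φ = 0) : LocalRing3 k →ₐ[k] MvPowerSeries (Fin 2) k :=
  (MvPowerSeries.substAlgHom (R := k) (hasSubst_section hφ)).comp
    (S.isParameterSystem.equiv.symm : LocalRing3 k →ₐ[k] LocalRing3 k)

section SectionMap

variable (S) {φ : MvPowerSeries (Fin 2) k} (hφ : MvPowerSeries.constantCoeff φ = 0)

theorem sectionMap_X (i : Fin 3) :
    S.sectionMap hφ (S.X i) = ![MvPowerSeries.X 0, MvPowerSeries.X 1, φ] i := by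
  change MvPowerSeries.substAlgHom (hasSubst_section hφ) (S.isParameterSystem.equiv.symm (S.X i)) = _
  rw [← S.isParameterSystem.equiv_X, AlgEquiv.symm_apply_apply, MvPowerSeries.substAlgHom_X]

theorem sectionMap_eval2 (F : MvPowerSeries (Fin 2) k) :
    S.sectionMap hφ (eval2 S.X F) = F := by
  have hsub := hasSubst_section hφ
  change MvPowerSeries.substAlgHom hsub (S.isParameterSystem.equiv.symm (eval2 S.X F)) = _
  rw [S.isParameterSystem.eval2_eq, AlgEquiv.symm_apply_apply,
    MvPowerSeries.substAlgHom_apply hsub, emb, MvPowerSeries.rename_eq_subst,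
    MvPowerSeries.subst_comp_subst_apply (MvPowerSeries.HasSubst.X_comp _) hsub]
  have h : (fun i : Fin 2 => MvPowerSeries.subst
      ![MvPowerSeries.X 0, MvPowerSeries.X 1, φ]
      ((MvPowerSeries.X ∘ (Fin.castSuccEmb : Fin 2 ↪ Fin 3)) i : LocalRing3 k)) =
      MvPowerSeries.X := by
    funext i
    rw [Function.comp_apply, MvPowerSeries.subst_X hsub]
    fin_cases i <;> rfl
  rw [h, MvPowerSeries.subst_self, id]

theorem sectionMap_h (hq : 0 < p ^ e) : S.sectionMap hφ S.h = φ ^ p ^ e +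
    ∑ i ∈ Finset.Ico 1 (p ^ e), S.coeff i * φ ^ (p ^ e - i) + S.coeff (p ^ e) := by
  rw [S.map_h _ hq]
  simp only [sectionMap_eval2, sectionMap_X]
  rfl

theorem isSection_sectionMap
    (h : PowerSeries.X ^ (p ^ e + 1) ∣ restrictY (S.sectionMap hφ S.h)) :
    S.IsSection (S.sectionMap hφ) := by
  refine ⟨?_, h, S.X 1, S.isParameterSystem.constantCoeff 1, ?_⟩
  · rw [sectionMap_X]; rfl
  · have h1 : S.sectionMap hφ (S.X 1) = MvPowerSeries.X 1 := sectionMap_X S hφ 1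
    rw [h1, restrictY_X_one, PowerSeries.X_pow_dvd_iff]
    intro h2
    have := h2 1 (by norm_num)
    rw [PowerSeries.coeff_one_X] at this
    exact one_ne_zero this

end SectionMap

end Situation

/-! ### Normal forms and their independence of the choices -/

namespace Situation

variable {p e : ℕ} {R : IdealisticFiltration k} {E : Set (Ideal (LocalRing3 k))}
  {D : Ideal (LocalRing3 k)}

/-- The slope is `r / q < μ`, and after a change of `z` the coefficient of `x^r` in `a_q` has
order `d`. -/
def HasNormalForm (S : Situation p e R E D) (r d : ℕ) : Prop :=
  r * S.a < S.α * p ^ e ∧ ∃ g G ω,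
    S.lastCoeff = MvPowerSeries.X 0 ^ r * (inclY g + MvPowerSeries.X 0 * ω) ∧
    IsLeadingForm (p ^ e) r d g G

/-- This is r/q < α/a ≤ ⌈αi/a⌉/i: the strict Newton polygon inequality for the exponents from
`X_pow_dvd_coeff`. -/
theorem mul_lt_ceil_mul (S : Situation p e R E D) {r i : ℕ} (hr : r * S.a < S.α * p ^ e)
    (hi : 0 < i) : r * i < ⌈(S.α : ℚ) * i / S.a⌉₊ * p ^ e := by
  have h1 : S.α * i ≤ ⌈(S.α : ℚ) * i / S.a⌉₊ * S.a := by
    have := Nat.le_ceil ((S.α : ℚ) * i / S.a)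
    rw [div_le_iff₀ (by exact_mod_cast S.a_pos)] at this
    exact_mod_cast this
  generalize ⌈(S.α : ℚ) * i / S.a⌉₊ = K at h1 ⊢
  have h2 : r * i * S.a < K * p ^ e * S.a := by
    calc r * i * S.a = r * S.a * i := by ring
      _ < S.α * p ^ e * i := Nat.mul_lt_mul_of_pos_right hr hi
      _ = S.α * i * p ^ e := by ring
      _ ≤ K * S.a * p ^ e := Nat.mul_le_mul_right _ h1
      _ = K * p ^ e * S.a := by ring
  exact Nat.lt_of_mul_lt_mul_right h2

variable [hp : Fact p.Prime]

/-- Congruence of the elements `h` of two choices modulo a power of `x`. -/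
theorem exists_eq_add_mul (S₀ S : Situation p e R E D) {r : ℕ}
    (hr : r * S₀.a < S₀.α * p ^ e) :
    ∃ c f₁, S₀.X 0 ^ (r + 1) ∣ c ∧ S.h = c + S₀.h * f₁ ∧ IsUnit f₁ := by
  obtain ⟨c, f₁, hc, h⟩ := S₀.exists_reduction S.h_mem
  have hK := S₀.mul_lt_ceil_mul hr (Nat.pow_pos (n := e) hp.out.pos)
  have hc' := (pow_dvd_pow _ (Nat.succ_le_of_lt (Nat.lt_of_mul_lt_mul_right hK))).trans hc
  exact ⟨c, f₁, hc', h, isUnit_of_eq S₀ S ((dvd_pow_self _ (Nat.succ_ne_zero r)).trans hc') h⟩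

/-- The two elements h differ by a multiple of x^(r+1) and a factor, so the ideals (x^(r+1), x^r
y^j) cannot tell them apart. The reverse direction below inverts the unit factor. -/
theorem IsSection.transfer {π : LocalRing3 k →ₐ[k] MvPowerSeries (Fin 2) k}
    {S₀ : Situation p e R E D} (S : Situation p e R E D) {r : ℕ}
    (hr : r * S₀.a < S₀.α * p ^ e) (hπ : S₀.IsSection π) :
    S.IsSection π ∧ ∀ j, LexDvd r j (π S₀.h) → LexDvd r j (π S.h) := by
  obtain ⟨c, f₁, hc, h, -⟩ := exists_eq_add_mul S₀ S hr
  refine ⟨hπ.of_eq ((dvd_pow_self _ (Nat.succ_ne_zero r)).trans hc) h, fun j hj => ?_⟩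
  rw [h, map_add, map_mul]
  exact (LexDvd.of_dvd j (hπ.X_pow_dvd hc)).add (hj.mul_right _)

theorem IsSection.transfer_symm {π : LocalRing3 k →ₐ[k] MvPowerSeries (Fin 2) k}
    {S₀ S : Situation p e R E D} {r : ℕ} (hr : r * S₀.a < S₀.α * p ^ e)
    (hπ : S.IsSection π) :
    S₀.IsSection π ∧ ∀ j, LexDvd r j (π S.h) → LexDvd r j (π S₀.h) := by
  obtain ⟨c, _, hc, h, ⟨u, rfl⟩⟩ := exists_eq_add_mul S₀ S hr
  have h' : S₀.h = -(c * ↑u⁻¹) + S.h * ↑u⁻¹ := by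
    rw [h, add_mul, mul_assoc, Units.mul_inv, mul_one, neg_add_cancel_left]
  have hc' : S.X 0 ^ (r + 1) ∣ -(c * ↑u⁻¹) :=
    dvd_neg.mpr ((((associated_X_zero S₀ S).pow_pow (n := r + 1)).dvd.trans hc).mul_right _)
  refine ⟨hπ.of_eq ((dvd_pow_self _ (Nat.succ_ne_zero r)).trans hc') h', fun j hj => ?_⟩
  rw [h', map_add, map_mul]
  exact (LexDvd.of_dvd j (hπ.X_pow_dvd hc')).add (hj.mul_right _)

theorem lt_of_coeff_ne_zero (S : Situation p e R E D) {n : ℕ}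
    (h : PowerSeries.coeff n (restrictY S.lastCoeff) ≠ 0) : p ^ e < n := by
  rw [coeff_restrictY] at h
  have h1 := (S.order_coeff (p ^ e) (Finset.mem_Icc.mpr
    ⟨Nat.one_le_pow _ _ hp.out.pos, le_rfl⟩)).trans_le (MvPowerSeries.order_le h)
  rw [Finsupp.degree_single] at h1
  exact_mod_cast h1

theorem natCast_div_lt_mu_iff (S : Situation p e R E D) (n : ℕ) :
    (n : ℝ≥0∞) / ((p ^ e : ℕ) : ℝ≥0∞) < S.mu ↔ n * S.a < S.α * p ^ e := by
  have hq : ((p ^ e : ℕ) : ℝ≥0∞) ≠ 0 := by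
    exact_mod_cast (Nat.pow_pos hp.out.pos).ne'
  have ha : (S.a : ℝ≥0∞) ≠ 0 := by exact_mod_cast S.a_pos.ne'
  rw [mu, ENNReal.div_lt_iff (Or.inl hq) (Or.inl (ENNReal.natCast_ne_top _)), mul_comm,
    ← mul_div_assoc, ENNReal.lt_div_iff_mul_lt (Or.inl ha) (Or.inl (ENNReal.natCast_ne_top _)),
    mul_comm _ (S.α : ℝ≥0∞)]
  exact_mod_cast Iff.rfl

theorem slope_lt_mu_iff (S : Situation p e R E D) :
    S.slope < S.mu ↔ ∃ r : ℕ, ordX S.lastCoeff = r ∧ r * S.a < S.α * p ^ e := by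
  rw [slope, min_lt_iff, or_iff_left (lt_irrefl _)]
  constructor
  · intro h
    cases hr : ordX S.lastCoeff with
    | top =>
      rw [hr, ENat.toENNReal_top, ENNReal.top_div_of_ne_top (ENNReal.natCast_ne_top _)] at h
      exact absurd h not_top_lt
    | coe r =>
      rw [hr, ENat.toENNReal_coe] at h
      exact ⟨r, rfl, (S.natCast_div_lt_mu_iff r).mp h⟩
  · rintro ⟨r, hr, h⟩
    rw [hr, ENat.toENNReal_coe]
    exact (S.natCast_div_lt_mu_iff r).mpr h

variable [CharP k p]

theorem HasNormalForm.not_lexDvd {S : Situation p e R E D} {r d : ℕ} (hS : S.HasNormalForm r d)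
    {π : LocalRing3 k →ₐ[k] MvPowerSeries (Fin 2) k} (hπ : S.IsSection π) :
    ¬ LexDvd r (d + 1) (π S.h) := by
  obtain ⟨hr, g, G, ω, hg, hG⟩ := hS
  have hX := S.isParameterSystem
  rw [S.map_h π (Nat.pow_pos hp.out.pos)]
  obtain ⟨v, hv⟩ := hπ.associated.symm
  let ev : MvPowerSeries (Fin 2) k →ₐ[k] MvPowerSeries (Fin 2) k :=
    (π.comp (hX.equiv : LocalRing3 k →ₐ[k] LocalRing3 k)).comp emb
  have hev : ∀ F, π (eval2 S.X F) = ev F := fun F => by rw [hX.eval2_eq]; rfl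
  have hev0 : ev (MvPowerSeries.X 0) = MvPowerSeries.X 0 * (v : MvPowerSeries (Fin 2) k) := by
    rw [hv, ← hX.equiv_X]
    exact congrArg (fun f => π (hX.equiv f)) (MvPowerSeries.rename_X _ 0)
  have hev1 : ev (MvPowerSeries.X 1) = π (S.X 1) := by
    rw [← hX.equiv_X]
    exact congrArg (fun f => π (hX.equiv f)) (MvPowerSeries.rename_X _ 1)
  refine not_lexDvd_of_isLeadingForm (c := fun i => π (eval2 S.X (S.coeff i)))
    (K := fun i => ⌈(S.α : ℚ) * i / S.a⌉₊) (v := (v : MvPowerSeries (Fin 2) k))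
    (w := ev (inclY g + MvPowerSeries.X 0 * ω))
    -- θ is the reparametrization of k[[y]] induced by π on x = 0, and v is the unit by which π
    -- rescales x.
    (θ := (restrictY.comp ev).comp inclY) ?_ ?_ ?_ v.isUnit ?_ ?_ hG
  · intro i hi hiq
    obtain ⟨u, hu⟩ := S.X_pow_dvd_coeff hi hiq
    simp only [hev, hu, map_mul, map_pow, hev0, mul_pow, mul_assoc]
    exact Dvd.intro _ rfl
  · intro i hi _
    exact S.mul_lt_ceil_mul hr hi
  · change π (eval2 S.X S.lastCoeff) = _
    rw [hev, hg, map_mul, map_pow, hev0, mul_pow, mul_assoc]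
  · rw [map_add, map_mul, hev0, map_add, map_mul, map_mul, restrictY_X_zero, zero_mul, zero_mul,
      add_zero]
    rfl
  · obtain ⟨u, hu, h⟩ := hπ.restrictY_X_one
    refine ⟨u, hu, ?_⟩
    change restrictY (ev (inclY PowerSeries.X)) = _
    rw [inclY_X, hev1, h]

theorem HasNormalForm.exists_lexDvd {S : Situation p e R E D} {r d : ℕ}
    (hS : S.HasNormalForm r d) : ∃ π, S.IsSection π ∧ LexDvd r d (π S.h) := by
  obtain ⟨hr, g, G, ω, hg, hG⟩ := hS
  have hq : 0 < p ^ e := Nat.pow_pos hp.out.pos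
  have hres : r = 0 → restrictY S.lastCoeff = g := by
    rintro rfl
    rw [hg, pow_zero, one_mul, map_add, restrictY_inclY, map_mul, restrictY_X_zero, zero_mul,
      add_zero]
  -- Only for r = 0 is anything to check: ord a_q > q gives d > q, needed for tangency, and G(0) =
  -- 0, needed for z to go into the maximal ideal.
  have hd : r = 0 → p ^ e < d := fun h0 => S.lt_of_coeff_ne_zero (by
    rw [hres h0]; exact hG.coeff_ne_zero)
  have hG0 : r = 0 → PowerSeries.constantCoeff G = 0 := by
    intro h0
    have hc : PowerSeries.constantCoeff g = 0 := by
      rw [← hres h0, ← PowerSeries.coeff_zero_eq_constantCoeff_apply]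
      by_contra h
      exact absurd (S.lt_of_coeff_ne_zero h) (Nat.not_lt_zero _)
    obtain ⟨U, -, hgG, -⟩ := hG
    rw [hgG, map_add, map_mul, map_pow, map_pow, PowerSeries.constantCoeff_X,
      zero_pow (by have := hd h0; omega), zero_mul, add_zero] at hc
    exact (pow_eq_zero_iff hq.ne').mp hc
  have hφ : MvPowerSeries.constantCoeff
      (-(MvPowerSeries.X 0 ^ (r / p ^ e) * inclY G) : MvPowerSeries (Fin 2) k) = 0 := by
    rw [map_neg, map_mul, map_pow, MvPowerSeries.constantCoeff_X, neg_eq_zero]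
    by_cases h0 : r / p ^ e = 0
    · rcases hG with ⟨U, -, -, ⟨-, rfl⟩ | ⟨hqr, -⟩⟩
      · rw [map_zero, map_zero, mul_zero]
      · have hr0 : r = 0 := by
          rw [← Nat.div_mul_cancel hqr, h0, zero_mul]
        have : MvPowerSeries.constantCoeff (inclY G) = PowerSeries.constantCoeff G :=
          constantCoeff_algHom (σ := Unit) inclY G
        rw [this, hG0 hr0, mul_zero]
    · rw [zero_pow h0, zero_mul]
  have hlex : LexDvd r d (S.sectionMap hφ S.h) := by
    rw [sectionMap_h S hφ hq]
    exact lexDvd_of_isLeadingForm (K := fun i => ⌈(S.α : ℚ) * i / S.a⌉₊)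
      (fun i hi hiq => S.X_pow_dvd_coeff hi hiq) (fun i hi _ => S.mul_lt_ceil_mul hr hi) hg hG rfl
  refine ⟨S.sectionMap hφ, isSection_sectionMap S hφ ?_, hlex⟩
  obtain ⟨w, hw, hdvd⟩ := hlex
  rw [hw, map_mul, map_pow, restrictY_X_zero]
  by_cases hr0 : r = 0
  · exact ((pow_dvd_pow _ (Nat.succ_le_of_lt (hd hr0))).trans hdvd).mul_left _
  · rw [zero_pow hr0, zero_mul]
    exact dvd_zero _

/-- The pair `(r, d)` does not depend on the choices. -/
theorem HasNormalForm.unique {S₀ S : Situation p e R E D} {r₀ d₀ r d : ℕ}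
    (h₀ : S₀.HasNormalForm r₀ d₀) (h : S.HasNormalForm r d) : r = r₀ ∧ d = d₀ := by
  -- An optimal section for `S₀` is also a section for `S`, and would beat the maximum (r, d) of `S`
  -- if that were lexicographically smaller than (r₀, d₀).
  have key : ∀ {S₀ S : Situation p e R E D} {r₀ d₀ r d : ℕ}, S₀.HasNormalForm r₀ d₀ →
      S.HasNormalForm r d → ¬ (r < r₀ ∨ r = r₀ ∧ d + 1 ≤ d₀) := by
    intro S₀ S r₀ d₀ r d h₀ h hlt
    obtain ⟨π, hπ, hlex⟩ := h₀.exists_lexDvd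
    obtain ⟨hπ', htr⟩ := hπ.transfer S h₀.1
    exact h.not_lexDvd hπ' ((htr _ hlex).mono hlt)
  have h1 := key h₀ h
  have h2 := key h h₀
  omega

/-- The section z = 0 sends h to a_q. Divisibility by x^(r+1) would make it a section exceeding the
maximum (r, d) of `S₀`. Well-adaptedness of `S` plays no role. -/
theorem HasNormalForm.not_X_pow_dvd {S₀ : Situation p e R E D} {r d : ℕ}
    (h₀ : S₀.HasNormalForm r d) (S : Situation p e R E D) :
    ¬ MvPowerSeries.X 0 ^ (r + 1) ∣ S.lastCoeff := by
  intro hdvd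
  have hφ : MvPowerSeries.constantCoeff (0 : MvPowerSeries (Fin 2) k) = 0 := map_zero _
  have hq : 0 < p ^ e := Nat.pow_pos hp.out.pos
  have hh : S.sectionMap hφ S.h = S.lastCoeff := by
    rw [sectionMap_h S hφ hq, zero_pow hq.ne', zero_add, Finset.sum_eq_zero, zero_add]
    · rfl
    · intro i hi
      rw [Finset.mem_Ico] at hi
      rw [zero_pow (by omega), mul_zero]
  have hsec : S.IsSection (S.sectionMap hφ) := by
    apply isSection_sectionMap
    rw [hh, restrictY_eq_zero_iff.mpr ((dvd_pow_self _ (Nat.succ_ne_zero r)).trans hdvd)]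
    exact dvd_zero _
  obtain ⟨hsec', htr⟩ := hsec.transfer_symm (S₀ := S₀) h₀.1
  exact h₀.not_lexDvd hsec' (htr _ (LexDvd.of_dvd _ (by rwa [hh])))

/-- The x-order of a_q for `S` is at most r, and r/q < μ(S₀) ≤ μ(S). This excludes the alternative
Slope = μ in the definition of well-adapted. -/
theorem HasNormalForm.slope_lt_mu {S₀ : Situation p e R E D} {r d : ℕ}
    (h₀ : S₀.HasNormalForm r d) (S : Situation p e R E D) : S.slope < S.mu := by
  have hndvd := h₀.not_X_pow_dvd S
  have hlt : ordX S.lastCoeff < ((r + 1 : ℕ) : ℕ∞) :=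
    emultiplicity_lt_iff_not_dvd.mpr hndvd
  obtain ⟨n, hn⟩ := ENat.ne_top_iff_exists.mp (ne_top_of_lt hlt)
  rw [← hn] at hlt
  have hnr : n ≤ r := Nat.lt_succ_iff.mp (by exact_mod_cast hlt)
  refine S.slope_lt_mu_iff.mpr ⟨n, hn.symm, ?_⟩
  have h2 : n * S.a * S₀.a < S.α * p ^ e * S₀.a := by
    calc n * S.a * S₀.a ≤ r * S.a * S₀.a := by gcongr
      _ = r * S₀.a * S.a := by ring
      _ < S₀.α * p ^ e * S.a := Nat.mul_lt_mul_of_pos_right h₀.1 S.a_pos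
      _ = S₀.α * S.a * p ^ e := by ring
      _ ≤ S.α * S₀.a * p ^ e := Nat.mul_le_mul_right _ (mul_a_le S₀ S)
      _ = _ := by ring
  exact Nat.lt_of_mul_lt_mul_right h2

variable [IsAlgClosed k]

/-- Not being a q-th power makes the residual order finite, equal to r + d. If q ∣ r, then d is the
residual order of g and G collects the lower terms; otherwise d = ord g and G = 0. -/
theorem exists_hasNormalForm {S : Situation p e R E D} (hS : S.IsWellAdapted)
    (hlt : S.slope < S.mu) : ∃ r d : ℕ, S.HasNormalForm r d ∧ ordX S.lastCoeff = r ∧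
      resOrd (p ^ e) (initX S.lastCoeff) = r + d := by
  obtain ⟨r, hr, hra⟩ := S.slope_lt_mu_iff.mp hlt
  obtain ⟨g, ω, hg⟩ := exists_eq_of_ordX hr
  have hnot : ¬ ∃ w : MvPowerSeries (Fin 2) k, initX S.lastCoeff = w ^ p ^ e := by
    rcases hS with h | ⟨-, -, h⟩
    · exact absurd h hlt.ne
    · exact h
  have hne : resOrd (p ^ e) (initX S.lastCoeff) ≠ ⊤ := fun h =>
    hnot (exists_pow_eq_of_resOrd_eq_top e h)
  have hinit := resOrd_X_zero_pow_mul (p := p) e r g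
  rw [← initX_eq hr hg] at hinit
  have hg0 : g ≠ 0 := (ordX_eq_iff hg).mp hr
  by_cases hqr : p ^ e ∣ r
  · rw [if_pos hqr] at hinit
    cases hd : resOrd (p ^ e) g with
    | top => rw [hinit, hd, add_top] at hne; exact (hne rfl).elim
    | coe d =>
      obtain ⟨hqd, -, G, U, hU, hgG⟩ := exists_of_resOrd_eq e hd
      exact ⟨r, d, ⟨hra, g, G, ω, hg, U, hU, hgG, Or.inr ⟨hqr, hqd⟩⟩, hr, by rw [hinit, hd]⟩
  · rw [if_neg hqr, ← PowerSeries.coe_toNat_order hg0] at hinit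
    refine ⟨r, g.order.toNat, ⟨hra, g, 0, ω, hg, PowerSeries.divXPowOrder g, ?_, ?_,
      Or.inl ⟨hqr, rfl⟩⟩, hr, hinit⟩
    · rw [PowerSeries.isUnit_iff_constantCoeff, isUnit_iff_ne_zero, ne_eq,
        PowerSeries.constantCoeff_divXPowOrder_eq_zero_iff]
      exact hg0
    · rw [zero_pow (pow_ne_zero _ hp.out.ne_zero), zero_add,
        PowerSeries.X_pow_order_mul_divXPowOrder]

end Situation

end MonomialCase

end

/-! ### The formulas for ρ and its invariance -/

theorem proposition7 {k : Type*} [Field k] [IsAlgClosed k] (p : ℕ) [Fact p.Prime] [CharP k p]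
    (e : ℕ) (R : MonomialCase.IdealisticFiltration k) (hR : R.IsIFG) (hP : R.IsSingular)
    (E : Set (Ideal (MonomialCase.LocalRing3 k))) (D : Ideal (MonomialCase.LocalRing3 k))
    (hbad : MonomialCase.IsBad p e R E D) :
    (∀ S : MonomialCase.Situation p e R E D, S.IsWellAdapted →
      MonomialCase.ordX S.lastCoeff ≠ ⊤ ∧
      MonomialCase.resOrd (p ^ e) (MonomialCase.initX S.lastCoeff) ≠ ⊤ ∧
      ∀ (g : PowerSeries k) (ω : MvPowerSeries (Fin 2) k),
        S.lastCoeff = MvPowerSeries.X 0 ^ S.r *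
          (PowerSeries.subst (MvPowerSeries.X 1 : MvPowerSeries (Fin 2) k) g +
            MvPowerSeries.X 0 * ω) →
        MonomialCase.initX S.lastCoeff = MvPowerSeries.X 0 ^ S.r *
          PowerSeries.subst (MvPowerSeries.X 1 : MvPowerSeries (Fin 2) k) g ∧
        (¬ p ^ e ∣ S.r → g.order ≠ ⊤ ∧
          S.rho = (g.order.toNat : ℚ) / ((p ^ e : ℕ) : ℚ)) ∧
        (p ^ e ∣ S.r → MonomialCase.resOrd (p ^ e) g ≠ ⊤ ∧
          S.rho = ((MonomialCase.resOrd (p ^ e) g).toNat : ℚ) / ((p ^ e : ℕ) : ℚ))) ∧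
    ∃ ρ : ℚ, ∀ S : MonomialCase.Situation p e R E D, S.IsWellAdapted → S.rho = ρ := by
  obtain ⟨S₀, hS₀, hlt₀⟩ := hbad
  obtain ⟨r₀, d₀, h₀, -, -⟩ := MonomialCase.Situation.exists_hasNormalForm hS₀ hlt₀
  have hrho : ∀ S : MonomialCase.Situation p e R E D, ∀ r d : ℕ,
      MonomialCase.ordX S.lastCoeff = r →
      MonomialCase.resOrd (p ^ e) (MonomialCase.initX S.lastCoeff) = r + d →
      S.r = r ∧ S.rho = (d : ℚ) / ((p ^ e : ℕ) : ℚ) := by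
    intro S r d hr hres
    have hSr : S.r = r := by rw [MonomialCase.Situation.r, hr, ENat.toNat_natCast]
    refine ⟨hSr, ?_⟩
    rw [MonomialCase.Situation.rho, hres, hSr, ← Nat.cast_add, ENat.toNat_natCast, Nat.cast_add,
      add_sub_cancel_left]
  refine ⟨fun S hS => ?_, (d₀ : ℚ) / ((p ^ e : ℕ) : ℚ), fun S hS => ?_⟩
  · obtain ⟨r, d, -, hr, hres⟩ :=
      MonomialCase.Situation.exists_hasNormalForm hS (h₀.slope_lt_mu S)
    obtain ⟨hSr, hSrho⟩ := hrho S r d hr hres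
    refine ⟨by rw [hr]; exact ENat.natCast_ne_top r, by
      rw [hres]; exact ENat.natCast_ne_top (r + d), ?_⟩
    intro g ω hg
    rw [hSr, MonomialCase.inclY_eq] at hg
    have hinit := MonomialCase.initX_eq hr hg
    rw [hinit, MonomialCase.resOrd_X_zero_pow_mul] at hres
    replace hres := ENat.add_right_injective_of_ne_top (ENat.natCast_ne_top r) hres
    rw [hSr, MonomialCase.inclY_eq]
    refine ⟨hinit, fun hqr => ?_, fun hqr => ?_⟩
    · rw [if_neg hqr] at hres
      rw [hres, ENat.toNat_natCast]
      exact ⟨ENat.natCast_ne_top d, hSrho⟩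
    · rw [if_pos hqr] at hres
      rw [hres, ENat.toNat_natCast]
      exact ⟨ENat.natCast_ne_top d, hSrho⟩
  · obtain ⟨r, d, h, hr, hres⟩ :=
      MonomialCase.Situation.exists_hasNormalForm hS (h₀.slope_lt_mu S)
    rw [(hrho S r d hr hres).2, (h₀.unique h).2]
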